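/- Consider the Gaussian random-design linear model with $n$ i.i.d. observations $D_i=(y_i,Z_i,\mathbf W_i)\in\mathbb R\times\mathbb R\times\mathbb R^{p-1}$, \[ y_i=Z_i\beta+\mathbf W_i^\top\boldsymbol\gamma+\varepsilon_i,\qquad \mathbf X_i=(Z_i,\mathbf W_i^\top)^\top\sim N_p(0,\boldsymbol\Sigma),\qquad \varepsilon_i\sim N(0,\sigma^2)\ \text{independent of } \mathbf X_i, \] with parameter $\theta=(\beta,\boldsymbol\gamma,\boldsymbol\Sigma,\sigma)$, and let $\mathbb E_\theta$ be expectation under the law of $(D_1,\dots,D_n)$. Fix constants $M>1$, $M_1,M_2>0$. For $b\in\mathbb R$ and an integer $s$, let $\widetilde\Theta(s,b)$ be the set of all $\theta$ with $\beta=b$, $M^{-1}\le\lambda_{\min}(\boldsymbol\Sigma)\le\lambda_{\max}(\boldsymbol\Sigma)\le M$, $0\le\sigma\le M_1$, $\|(\beta,\boldsymbol\gamma^\top)^\top\|_2\le M_2$, and such that the first row of $\boldsymbol\Omega=\boldsymbol\Sigma^{-1}$ has at most $s$ nonzero entries. No sparsity of $\boldsymbol\gamma$ is imposed. For a set $T$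 of parameters and $\alpha\in(0,1)$, let $\Psi_\alpha(T)$ be the set of all (possibly randomized) tests, i.e. measurable maps $\psi$ from the data to $[0,1]$, with $\sup_{\theta\in T}\mathbb E_\theta\psi\le\alpha$. Let $\alpha\in(0,1)$ and $c<1/2$. There is a constant $h_0>0$, depending only on $\alpha,c,M,M_1,M_2$, such that the following holds. Let $p=p_n$ and $s=s_n$ be sequences of positive integers with $s n^{-1}\log p\le 1/4$ and $2\le s\le p^{c}$ for all large $n$, and put $h_n=h_0\,(n^{-1/2}+s n^{-1}\log p)$. Then for every $\beta_0\in\mathbb R$ for which $\widetilde\Theta(s,\beta_0)$ and $\widetilde\Theta(s,\beta_0+h_n)$ are nonempty for all large $n$ (that is, $|\beta_0|\le M_2$ and $|\beta_0+h_n|\le M_2$), \[ \limsup_{n\to\infty}\ \sup_{\psi\in\Psi_\alpha(\widetilde\Theta(s,\beta_0))}\ \inf_{\theta\in\widetilde\Theta(s,\beta_0+h_n)}\mathbb E_\theta\psi\ \le\ 2\alpha . \] -/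

import Mathlib

open MeasureTheory ProbabilityTheory Filter

namespace DenseRegression

/-- The parameter `θ = (β, γ, Σ, σ)` of the Gaussian random-design regression
`y = Z β + W γ + ε` with `p = d + 1` covariates `X = (Z, W) ∈ ℝ × ℝ^d`. -/
structure Param (d : ℕ) where
  /-- coefficient of the covariate of interest `Z` -/
  beta : ℝ
  /-- coefficients of the remaining covariates `W` -/
  gamma : Fin d → ℝ
  /-- covariance matrix of `X = (Z, W)`; index `0` belongs to `Z` -/
  cov : Matrix (Fin (d + 1)) (Fin (d + 1)) ℝ
  /-- standard deviation of the noise -/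
  sigma : ℝ

/-- One observation `(y, Z, W)`. -/
abbrev Obs (d : ℕ) : Type := ℝ × ℝ × (Fin d → ℝ)

namespace Param

/-- The full coefficient vector `(β, γ) ∈ ℝ^p`, with its Euclidean norm. -/
noncomputable def coeff {d : ℕ} (θ : Param d) : EuclideanSpace ℝ (Fin (d + 1)) :=
  WithLp.toLp 2 (Fin.cons θ.beta θ.gamma)

/-- The precision matrix `Ω = Σ⁻¹`. -/
noncomputable def precision {d : ℕ} (θ : Param d) : Matrix (Fin (d + 1)) (Fin (d + 1)) ℝ :=
  θ.cov⁻¹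

/-- The law of one observation `(y, Z, W)`: `X = (Z, W) ∼ N(0, Σ)`, independently
`ε ∼ N(0, σ²)`, and `y = Z β + W γ + ε`. -/
noncomputable def obsLaw {d : ℕ} (θ : Param d) : Measure (Obs d) :=
  ((multivariateGaussian (0 : EuclideanSpace ℝ (Fin (d + 1))) θ.cov).prod
      (gaussianReal 0 (Real.toNNReal (θ.sigma ^ 2)))).map
    fun q => (q.1 0 * θ.beta + (∑ j : Fin d, q.1 j.succ * θ.gamma j) + q.2,
      q.1 0, fun j : Fin d => q.1 j.succ)

/-- The law of the data `D = (D₁, …, Dₙ)`, `n` i.i.d. observations. -/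
noncomputable def dataLaw {d : ℕ} (n : ℕ) (θ : Param d) : Measure (Fin n → Obs d) :=
  Measure.pi fun _ : Fin n => θ.obsLaw

end Param

/-- The parameter space: all eigenvalues of the (symmetric) covariance matrix lie in
`[M⁻¹, M]`, `0 ≤ σ ≤ M₁`, and `‖(β, γ)‖₂ ≤ M₂`. -/
def paramSpace (d : ℕ) (M M₁ M₂ : ℝ) : Set (Param d) :=
  {θ | (∃ hS : θ.cov.IsHermitian, ∀ i, M⁻¹ ≤ hS.eigenvalues i ∧ hS.eigenvalues i ≤ M) ∧
    0 ≤ θ.sigma ∧ θ.sigma ≤ M₁ ∧ ‖θ.coeff‖ ≤ M₂}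

/-- The points of the parameter space with `β = b` for which the first row of the precision
matrix has at most `s` nonzero entries. -/
def sparseSpace (d : ℕ) (M M₁ M₂ : ℝ) (s : ℕ) (b : ℝ) : Set (Param d) :=
  {θ | θ ∈ paramSpace d M M₁ M₂ ∧ θ.beta = b ∧ {j | θ.precision 0 j ≠ 0}.ncard ≤ s}

/-- Expectation `E_θ ψ` of a statistic of the data. -/
noncomputable def expect {d : ℕ} (n : ℕ) (θ : Param d) (ψ : (Fin n → Obs d) → ℝ) : ℝ :=
  ∫ D, ψ D ∂(θ.dataLaw n)

/-- The (possibly randomized) tests of nominal level `α` for the null hypothesis `θ ∈ T`: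
measurable maps from the data to `[0, 1]`, the value being the probability of rejection. -/
def levelTests {d : ℕ} (n : ℕ) (α : ℝ) (T : Set (Param d)) : Set ((Fin n → Obs d) → ℝ) :=
  {ψ | Measurable ψ ∧ (∀ D, 0 ≤ ψ D ∧ ψ D ≤ 1) ∧ ∀ θ ∈ T, expect n θ ψ ≤ α}

/-- The minimax power of the level-`α` tests of `θ ∈ T₀` against `θ ∈ T₁`:
supremum over the tests of the infimum over the alternative of the rejection probability. -/
noncomputable def minimaxPower {d : ℕ} (n : ℕ) (α : ℝ) (T₀ T₁ : Set (Param d)) : EReal :=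
  ⨆ ψ ∈ levelTests n α T₀, ⨅ θ ∈ T₁, ((expect n θ ψ : ℝ) : EReal)

/-- The separation `h₀ (n^{-1/2} + s n⁻¹ log p)`. -/
noncomputable def separation (h₀ : ℝ) (n p s : ℕ) : ℝ :=
  h₀ * ((n : ℝ) ^ (-(1 / 2) : ℝ) + (s : ℝ) * Real.log p / n)

end DenseRegression

namespace DenseRegression

/-! The argument is Le Cam's two-point method with a mixture on one side. If one hypothesis contains
a point and the other contains a finite family whose averaged data law has chi-square distance at
most `α ^ 2` from the law at that point, then every test has nearly the same mean under both, up to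
`α`. A level-`α` test therefore has power at most `2 * α` somewhere on the alternative.

When the `n^{-1/2}` term dominates, a single alternative suffices: moving `β` with `γ = 0` is a
Gaussian shift of the noise by a multiple of `z`.

When `s log p / n` dominates, the perturbation is hidden in the nuisance covariates. Start from
independent standard Gaussian `z`, `e`, `ξ` with `y = B z + σ e`, `Z = z`, and set `W = ξ + (e + m
z) a` with `m = ±1` and `a` sparse. The pair `(y, Z)` does not change, but `W` now correlates with
both noise and `Z`. With `t = ‖a‖²`, regressing on `(Z, W)` moves the coefficient of `Z` to `B - m σ
t / (1 + t)`, and the first row of `Ω` is supported on `0` and the support of `a`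
(`obsLaw_spikedParam`, `spikedParam_precision_zero`).

Let `a` have `k = s - 1` equal entries, one placed uniformly in each of `k` blocks of size `q ≈ p /
k`. The overlap of two draws is a sum of `k` independent indicators of probability `1 / q`, and the
second moment is at most `exp (k e^λ / q)` with `λ = 8 n t / k` (`lintegral_spikeDensity_mul_le`,
`sum_exp_agreement_le`). For `t` a small multiple of `s log p / n`, `e^λ` is a small power of `p`;
since `k² ≤ p^{2c}` with `2c < 1`, the exponent tends to zero.

The bound on `‖(β, γ)‖` needs care near its boundary: a spike has `γ ≠ 0`, so the mixture goes on
whichever of the two values of `β` is smaller in absolute value, possibly the null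
(`minimaxPower_le_of_sparse_gap`). -/

/-! ### Product densities, Gaussian shifts and the second-moment method -/

theorem lintegral_pi_prod {ι : Type*} [Fintype ι] {X : ι → Type*} [∀ i, MeasurableSpace (X i)]
    (μ : ∀ i, Measure (X i)) [∀ i, IsProbabilityMeasure (μ i)] (f : ∀ i, X i → ENNReal)
    (hf : ∀ i, Measurable (f i)) :
    ∫⁻ x, ∏ i, f i (x i) ∂(Measure.pi μ) = ∏ i, ∫⁻ y, f i y ∂(μ i) := by
  have hind : iIndepFun (fun i (x : ∀ i, X i) => f i (x i)) (Measure.pi μ) :=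
    iIndepFun_pi (X := fun i => f i) fun i => (hf i).aemeasurable
  rw [lintegral_prod_eq_prod_lintegral_of_indepFun Finset.univ (fun i (x : ∀ i, X i) => f i (x i))
    hind fun i => (hf i).comp (measurable_pi_apply i)]
  refine Finset.prod_congr rfl fun i _ => ?_
  rw [← (measurePreserving_eval μ i).map_eq, lintegral_map (hf i) (measurable_pi_apply i)]

theorem pi_withDensity {ι : Type*} [Fintype ι] {X : ι → Type*} [∀ i, MeasurableSpace (X i)]
    (μ : ∀ i, Measure (X i)) [∀ i, IsProbabilityMeasure (μ i)] (f : ∀ i, X i → ENNReal)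
    (hf : ∀ i, Measurable (f i)) [∀ i, IsProbabilityMeasure ((μ i).withDensity (f i))] :
    Measure.pi (fun i => (μ i).withDensity (f i))
      = (Measure.pi μ).withDensity fun x => ∏ i, f i (x i) := by
  refine Measure.pi_eq fun s hs => ?_
  rw [withDensity_apply _ (MeasurableSet.univ_pi hs),
    ← lintegral_indicator (MeasurableSet.univ_pi hs)]
  have h : (Set.univ.pi s).indicator (fun x : ∀ i, X i => ∏ i, f i (x i))
      = fun x => ∏ i, (s i).indicator (f i) (x i) := by
    funext x
    by_cases hx : x ∈ Set.univ.pi s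
    · rw [Set.indicator_of_mem hx]
      exact Finset.prod_congr rfl fun i _ => by rw [Set.indicator_of_mem (hx i trivial)]
    · rw [Set.indicator_of_notMem hx]
      simp only [Set.mem_pi, Set.mem_univ, true_implies, not_forall] at hx
      obtain ⟨i, hi⟩ := hx
      exact (Finset.prod_eq_zero (Finset.mem_univ i) (Set.indicator_of_notMem hi _)).symm
  rw [h, lintegral_pi_prod μ _ fun i => (hf i).indicator (hs i)]
  exact Finset.prod_congr rfl fun i _ => by
    rw [lintegral_indicator (hs i), withDensity_apply _ (hs i)]

theorem gaussianReal_eq_withDensity (c : ℝ) :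
    gaussianReal c 1 = (gaussianReal 0 1).withDensity
      fun x => ENNReal.ofReal (Real.exp (c * x - c ^ 2 / 2)) := by
  rw [gaussianReal_of_var_ne_zero c one_ne_zero, gaussianReal_of_var_ne_zero 0 one_ne_zero,
    ← withDensity_mul _ (measurable_gaussianPDF 0 1) (by fun_prop)]
  congr 1
  funext x
  simp only [gaussianPDF, Pi.mul_apply, gaussianPDFReal]
  rw [← ENNReal.ofReal_mul (by positivity), mul_assoc (Real.sqrt _)⁻¹, ← Real.exp_add]
  congr 3
  simp
  ring

theorem map_add_pi_gaussianReal {ι : Type*} [Fintype ι] (c : ι → ℝ) :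
    (Measure.pi fun _ : ι => gaussianReal 0 1).map (fun x => x + c)
      = (Measure.pi fun _ : ι => gaussianReal 0 1).withDensity
        fun x => ENNReal.ofReal (Real.exp (∑ i, c i * x i - (∑ i, c i ^ 2) / 2)) := by
  have h1 : ∀ i, (gaussianReal 0 1).map (fun x => x + c i)
      = (gaussianReal 0 1).withDensity
        fun x => ENNReal.ofReal (Real.exp (c i * x - c i ^ 2 / 2)) := fun i => by
    rw [gaussianReal_map_add_const, zero_add, gaussianReal_eq_withDensity]
  have : ∀ i, IsProbabilityMeasure ((gaussianReal 0 1).withDensity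
      fun x => ENNReal.ofReal (Real.exp (c i * x - c i ^ 2 / 2))) := fun i => by
    rw [← h1 i]; exact Measure.isProbabilityMeasure_map (by fun_prop)
  have h2 : (Measure.pi fun _ : ι => gaussianReal 0 1).map (fun x => x + c)
      = Measure.pi fun i => (gaussianReal 0 1).map (fun x => x + c i) :=
    (Measure.pi_map_pi (μ := fun _ : ι => gaussianReal 0 1) (f := fun i x => x + c i)
      (fun i => by fun_prop))
  rw [h2]
  simp_rw [h1]
  rw [pi_withDensity (fun _ : ι => gaussianReal 0 1) _ fun i => by fun_prop]
  congr 1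
  funext x
  rw [← ENNReal.ofReal_prod_of_nonneg fun i _ => (Real.exp_pos _).le, ← Real.exp_sum,
    Finset.sum_sub_distrib, Finset.sum_div]

/-- By Tonelli the claim reduces to each fibre. It turns conditional shifts, whose size depends on
the other coordinates, into densities on the joint space. -/
theorem map_prod_fiberwise {Ω X : Type*} [MeasurableSpace Ω] [MeasurableSpace X]
    (P : Measure Ω) (ν : Measure X) [SFinite P] [SFinite ν] (T : Ω → X → X)
    (f : Ω → X → ENNReal) (hT : Measurable (Function.uncurry T))
    (hf : Measurable (Function.uncurry f)) (h : ∀ ω, ν.map (T ω) = ν.withDensity (f ω)) :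
    (P.prod ν).map (fun q => (q.1, T q.1 q.2))
      = (P.prod ν).withDensity fun q => f q.1 q.2 := by
  have hm : Measurable fun q : Ω × X => (q.1, T q.1 q.2) := measurable_fst.prodMk hT
  have hf' : Measurable fun q : Ω × X => f q.1 q.2 := hf
  refine Measure.ext_of_lintegral _ fun g hg => ?_
  have hgm : Measurable fun q : Ω × X => g (q.1, T q.1 q.2) := hg.comp hm
  rw [lintegral_map hg hm, lintegral_prod _ hgm.aemeasurable,
    lintegral_withDensity_eq_lintegral_mul _ hf' hg,
    lintegral_prod _ (hf'.mul hg).aemeasurable]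
  refine lintegral_congr fun ω => ?_
  have hg' : Measurable fun x => g (ω, x) := hg.comp measurable_prodMk_left
  have h1 := lintegral_map (μ := ν) hg' (hT.comp (measurable_prodMk_left (x := ω)))
  have h2 := lintegral_withDensity_eq_lintegral_mul ν
    (hf.comp (measurable_prodMk_left (x := ω))) hg'
  have h3 : ν.map (Function.uncurry T ∘ Prod.mk ω)
    = ν.withDensity (Function.uncurry f ∘ Prod.mk ω) := h ω
  rw [h3, h2] at h1
  exact h1.symm

/-- The integral equals `(1 - 2 y)^{-1/2}`. Since `(1 + 4 y) (1 - 2 y) ≥ 1` exactly when `0 ≤ y ≤ 1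
/ 4`, it is at most `exp (2 y)`. -/
theorem lintegral_exp_sq_gaussianReal_le {y : ℝ} (hy0 : 0 ≤ y) (hy : y ≤ 1 / 4) :
    ∫⁻ x, ENNReal.ofReal (Real.exp (y * x ^ 2)) ∂(gaussianReal 0 1)
      ≤ ENNReal.ofReal (Real.exp (2 * y)) := by
  have hb : 0 < 1 / 2 - y := by linarith
  rw [gaussianReal_of_var_ne_zero 0 one_ne_zero,
    lintegral_withDensity_eq_lintegral_mul _ (measurable_gaussianPDF 0 1) (by fun_prop)]
  have h1 : ∀ x : ℝ, (gaussianPDF 0 1 * fun x => ENNReal.ofReal (Real.exp (y * x ^ 2))) x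
      = ENNReal.ofReal ((√(2 * Real.pi))⁻¹ * Real.exp (-(1 / 2 - y) * x ^ 2)) := fun x => by
    simp only [gaussianPDF, Pi.mul_apply, gaussianPDFReal]
    rw [← ENNReal.ofReal_mul (by positivity), mul_assoc, ← Real.exp_add]
    congr 3
    · simp
    · simp
      ring
  simp_rw [h1]
  rw [← ofReal_integral_eq_lintegral_ofReal
    ((integrable_exp_neg_mul_sq hb).const_mul _) (ae_of_all _ fun x => by positivity),
    integral_const_mul, integral_gaussian]
  apply ENNReal.ofReal_le_ofReal
  rw [← Real.sqrt_inv, ← Real.sqrt_mul (by positivity), Real.sqrt_le_left (by positivity),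
    ← Real.exp_nat_mul]
  have h2 : (2 * Real.pi)⁻¹ * (Real.pi / (1 / 2 - y)) = 1 / (1 - 2 * y) := by
    have : 1 - 2 * y ≠ 0 := by linarith
    have := Real.pi_pos.ne'
    field_simp
  rw [h2, div_le_iff₀ (by linarith)]
  have h3 := Real.add_one_le_exp ((2 : ℕ) * (2 * y))
  push_cast at h3 ⊢
  nlinarith

/-- With `L` the average of the likelihood ratios, the difference is `∫ (L - 1) ψ`, and `∫ (L - 1)²
≤ α²` by expanding the square into the pairwise bounds `K`. In place of Cauchy–Schwarz, the
pointwise inequality `|L - 1| ≤ (α + (L - 1)² / α) / 2` is integrated. -/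
theorem abs_avg_sub_le_of_chiSq {Ω ι : Type*} [MeasurableSpace Ω] [Fintype ι] [Nonempty ι]
    (Q : Measure Ω) [IsProbabilityMeasure Q] (g : ι → Ω → ℝ) (hg : ∀ i, Measurable (g i))
    (hg0 : ∀ i x, 0 ≤ g i x) (h1 : ∀ i, ∫⁻ x, ENNReal.ofReal (g i x) ∂Q = 1)
    (K : ι → ι → ℝ) (hK0 : ∀ i j, 0 ≤ K i j)
    (hK : ∀ i j, ∫⁻ x, ENNReal.ofReal (g i x * g j x) ∂Q ≤ ENNReal.ofReal (K i j))
    {α : ℝ} (hα : 0 < α)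
    (hsum : ∑ i, ∑ j, K i j ≤ (1 + α ^ 2) * (Fintype.card ι : ℝ) ^ 2)
    (ψ : Ω → ℝ) (hψ : Measurable ψ) (hψ01 : ∀ x, 0 ≤ ψ x ∧ ψ x ≤ 1) :
    |(∑ i, ∫ x, ψ x ∂(Q.withDensity fun x => ENNReal.ofReal (g i x))) / Fintype.card ι
      - ∫ x, ψ x ∂Q| ≤ α := by
  set N : ℝ := (Fintype.card ι : ℝ) with hN
  have hNpos : 0 < N := by rw [hN]; exact_mod_cast Fintype.card_pos
  have hgi : ∀ i, Integrable (g i) Q := fun i =>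
    ⟨(hg i).aestronglyMeasurable, by
      rw [hasFiniteIntegral_iff_ofReal (ae_of_all _ (hg0 i)), h1]; exact ENNReal.one_lt_top⟩
  have hint1 : ∀ i, ∫ x, g i x ∂Q = 1 := fun i => by
    rw [integral_eq_lintegral_of_nonneg_ae (ae_of_all _ (hg0 i)) (hg i).aestronglyMeasurable, h1]
    rfl
  have hggi : ∀ i j, Integrable (fun x => g i x * g j x) Q := fun i j =>
    ⟨((hg i).mul (hg j)).aestronglyMeasurable, by
      rw [hasFiniteIntegral_iff_ofReal (ae_of_all _ fun x => mul_nonneg (hg0 i x) (hg0 j x))]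
      exact (hK i j).trans_lt ENNReal.ofReal_lt_top⟩
  have hgg : ∀ i j, ∫ x, g i x * g j x ∂Q ≤ K i j := fun i j => by
    rw [integral_eq_lintegral_of_nonneg_ae
      (ae_of_all _ fun x => mul_nonneg (hg0 i x) (hg0 j x))
      ((hg i).mul (hg j)).aestronglyMeasurable]
    exact ENNReal.toReal_le_of_le_ofReal (hK0 i j) (hK i j)
  have hψi : ∀ i, ∫ x, ψ x ∂(Q.withDensity fun x => ENNReal.ofReal (g i x))
      = ∫ x, g i x * ψ x ∂Q := fun i => by
    rw [integral_withDensity_eq_integral_toReal_smul (hg i).ennreal_ofReal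
      (ae_of_all _ fun x => ENNReal.ofReal_lt_top)]
    refine integral_congr_ae (ae_of_all _ fun x => ?_)
    simp [ENNReal.toReal_ofReal (hg0 i x)]
  have hψb : ∀ x, ‖ψ x‖ ≤ 1 := fun x => by
    rw [Real.norm_eq_abs, abs_of_nonneg (hψ01 x).1]; exact (hψ01 x).2
  have hgψi : ∀ i, Integrable (fun x => g i x * ψ x) Q := fun i =>
    (hgi i).mul_bdd hψ.aestronglyMeasurable (ae_of_all _ hψb)
  have hψint : Integrable ψ Q := Integrable.of_bound hψ.aestronglyMeasurable 1 (ae_of_all _ hψb)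
  set L : Ω → ℝ := fun x => (∑ i, g i x) / N with hL
  have hLint : Integrable L Q := (integrable_finsetSum _ fun i _ => hgi i).div_const _
  have hL1 : ∫ x, L x ∂Q = 1 := by
    rw [hL, integral_div, integral_finsetSum _ fun i _ => hgi i]
    simp only [hint1, Finset.sum_const, Finset.card_univ, nsmul_eq_mul, mul_one]
    exact div_self hNpos.ne'
  have hLsq : ∀ x, L x ^ 2 = (∑ i, ∑ j, g i x * g j x) / N ^ 2 := fun x => by
    simp only [hL, div_pow, sq (∑ i, g i x), Finset.sum_mul_sum]
  have hL2int : Integrable (fun x => L x ^ 2) Q := by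
    simp_rw [hLsq]
    exact (integrable_finsetSum _ fun i _ => integrable_finsetSum _ fun j _ =>
      hggi i j).div_const _
  have hL2 : ∫ x, L x ^ 2 ∂Q ≤ 1 + α ^ 2 := by
    simp_rw [hLsq]
    rw [integral_div, integral_finsetSum _ fun i _ => integrable_finsetSum _ fun j _ => hggi i j,
      div_le_iff₀ (by positivity)]
    refine le_trans (Finset.sum_le_sum fun i _ => ?_) hsum
    rw [integral_finsetSum _ fun j _ => hggi i j]
    exact Finset.sum_le_sum fun j _ => hgg i j
  have hLψ : Integrable (fun x => L x * ψ x) Q :=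
    hLint.mul_bdd hψ.aestronglyMeasurable (ae_of_all _ hψb)
  have hkey : (∑ i, ∫ x, ψ x ∂(Q.withDensity fun x => ENNReal.ofReal (g i x))) / N
      - ∫ x, ψ x ∂Q = ∫ x, (L x - 1) * ψ x ∂Q := by
    have : (fun x => (L x - 1) * ψ x) = fun x => L x * ψ x - ψ x := by funext x; ring
    rw [this, integral_sub hLψ hψint]
    congr 1
    simp_rw [hψi]
    rw [← integral_finsetSum _ fun i _ => hgψi i, ← integral_div]
    refine integral_congr_ae (ae_of_all _ fun x => ?_)
    simp only [hL]
    rw [div_mul_eq_mul_div, Finset.sum_mul]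
  have hD : Integrable (fun x => (L x - 1) * ψ x) Q := by
    have : (fun x => (L x - 1) * ψ x) = fun x => L x * ψ x - ψ x := by funext x; ring
    rw [this]; exact hLψ.sub hψint
  have hA : Integrable (fun x => L x ^ 2 - 2 * L x) Q := hL2int.sub (hLint.const_mul 2)
  have hB : Integrable (fun x => (L x ^ 2 - 2 * L x + 1) / α) Q :=
    (hA.add (integrable_const 1)).div_const α
  have hVint : Integrable (fun x => (α + (L x ^ 2 - 2 * L x + 1) / α) / 2) Q :=
    ((integrable_const α).add hB).div_const 2
  have hV : ∫ x, (α + (L x ^ 2 - 2 * L x + 1) / α) / 2 ∂Q ≤ α := by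
    have e1 : ∫ x, (α + (L x ^ 2 - 2 * L x + 1) / α) / 2 ∂Q
        = (α + ((∫ x, L x ^ 2 ∂Q) - 2 * 1 + 1) / α) / 2 := by
      rw [integral_div, integral_add (integrable_const _) hB, integral_div,
        integral_add hA (integrable_const 1),
        integral_sub hL2int (hLint.const_mul 2), integral_const_mul, hL1]
      simp
    rw [e1]
    have : ((∫ x, L x ^ 2 ∂Q) - 2 * 1 + 1) / α ≤ α := by
      rw [div_le_iff₀ hα]; nlinarith
    linarith
  rw [hkey]
  refine (abs_integral_le_integral_abs).trans (le_trans (integral_mono hD.abs hVint fun x => ?_) hV)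
  have hx := hψ01 x
  have h4 : |(L x - 1) * ψ x| ≤ |L x - 1| := by
    rw [abs_mul, abs_of_nonneg hx.1]
    exact mul_le_of_le_one_right (abs_nonneg _) hx.2
  refine h4.trans ?_
  have h5 : L x ^ 2 - 2 * L x + 1 = |L x - 1| ^ 2 := by rw [sq_abs]; ring
  simp only [h5]
  rw [le_div_iff₀ two_pos, ← sub_nonneg]
  have : α + |L x - 1| ^ 2 / α - |L x - 1| * 2 = (α - |L x - 1|) ^ 2 / α := by
    field_simp; ring
  rw [this]; positivity

/-! ### The spiked model: covariance and precision matrix -/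

open Matrix in
/-- The parameter under which, for standard Gaussian `z`, `e`, `ξ`, the observation is distributed
as `(B z + σ e, z, ξ + (e + m z) a)` when `m ^ 2 = 1`. -/
noncomputable def spikedParam {d : ℕ} (B m σ : ℝ) (a : Fin d → ℝ) : Param d where
  beta := B - m * σ * (∑ j, a j ^ 2) / (1 + ∑ j, a j ^ 2)
  gamma := fun j => σ * a j / (1 + ∑ j, a j ^ 2)
  cov := 1 + m • (vecMulVec (Pi.single 0 1) (Fin.cons 0 a) + vecMulVec (Fin.cons 0 a) (Pi.single 0 1))
    + (2 : ℝ) • vecMulVec (Fin.cons 0 a) (Fin.cons 0 a)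
  sigma := σ / √(1 + ∑ j, a j ^ 2)

theorem cons_zero_dotProduct {d : ℕ} (a : Fin d → ℝ) (x : Fin (d + 1) → ℝ) :
    (Fin.cons 0 a : Fin (d + 1) → ℝ) ⬝ᵥ x = ∑ j, a j * x j.succ := by
  simp [dotProduct, Fin.sum_univ_succ]

theorem isHermitian_spikedParam_cov {d : ℕ} (B m σ : ℝ) (a : Fin d → ℝ) :
    (spikedParam B m σ a).cov.IsHermitian := by
  ext i j
  simp only [spikedParam, Matrix.conjTranspose_apply, Matrix.add_apply, Matrix.smul_apply,
    Matrix.vecMulVec_apply, star_trivial, Matrix.one_apply, smul_eq_mul]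
  simp only [eq_comm (a := j) (b := i)]
  ring

theorem dotProduct_spikedParam_cov {d : ℕ} (B m σ : ℝ) (a : Fin d → ℝ) (x : Fin (d + 1) → ℝ) :
    x ⬝ᵥ ((spikedParam B m σ a).cov.mulVec x)
      = x 0 ^ 2 + ∑ j : Fin d, x j.succ ^ 2 + 2 * m * x 0 * (∑ j, a j * x j.succ)
        + 2 * (∑ j, a j * x j.succ) ^ 2 := by
  have hx : x ⬝ᵥ x = x 0 ^ 2 + ∑ j : Fin d, x j.succ ^ 2 := by
    simp [dotProduct, Fin.sum_univ_succ, sq]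
  have h2 : x ⬝ᵥ (Fin.cons 0 a : Fin (d + 1) → ℝ) = ∑ j, a j * x j.succ := by
    rw [dotProduct_comm, cons_zero_dotProduct]
  simp only [spikedParam, Matrix.add_mulVec, Matrix.smul_mulVec, Matrix.one_mulVec,
    Matrix.vecMulVec_mulVec, dotProduct_add, dotProduct_smul, hx, cons_zero_dotProduct,
    single_dotProduct, one_mul, op_smul_eq_smul, h2, dotProduct_single, smul_eq_mul]
  ring

/-- When `m ^ 2 = 1` the quadratic form is a sum of squares: the variances contributed by `ξ`, `z`
and `e` to a linear combination of the covariates. -/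
theorem posDef_spikedParam_cov {d : ℕ} (B σ : ℝ) {m : ℝ} (hm : m ^ 2 = 1) (a : Fin d → ℝ) :
    (spikedParam B m σ a).cov.PosDef := by
  refine Matrix.PosDef.of_dotProduct_mulVec_pos (isHermitian_spikedParam_cov B m σ a)
    fun x hx => ?_
  rw [star_trivial, dotProduct_spikedParam_cov]
  have e : x 0 ^ 2 + ∑ j : Fin d, x j.succ ^ 2 + 2 * m * x 0 * (∑ j, a j * x j.succ)
        + 2 * (∑ j, a j * x j.succ) ^ 2
      = ∑ j : Fin d, x j.succ ^ 2 + (x 0 + m * ∑ j, a j * x j.succ) ^ 2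
        + (∑ j, a j * x j.succ) ^ 2 := by
    linear_combination (-(∑ j, a j * x j.succ) ^ 2) * hm
  rw [e]
  have h0 : 0 ≤ ∑ j : Fin d, x j.succ ^ 2 := Finset.sum_nonneg fun j _ => sq_nonneg _
  by_contra hneg
  have hs : ∑ j : Fin d, x j.succ ^ 2 = 0 := by
    nlinarith [sq_nonneg (x 0 + m * ∑ j, a j * x j.succ), sq_nonneg (∑ j, a j * x j.succ)]
  have hj : ∀ j : Fin d, x j.succ = 0 := fun j => by
    have := (Finset.sum_eq_zero_iff_of_nonneg fun j _ => sq_nonneg (x (Fin.succ j))).1 hs j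
      (Finset.mem_univ j)
    exact pow_eq_zero_iff two_ne_zero |>.1 this
  simp only [hj, mul_zero, Finset.sum_const_zero, add_zero] at hneg
  apply hx
  funext i
  refine Fin.cases ?_ hj i
  simp at hneg
  exact hneg

theorem spikedParam_precision_zero {d : ℕ} (B σ : ℝ) {m : ℝ} (hm : m ^ 2 = 1) (a : Fin d → ℝ)
    (j : Fin d) :
    (spikedParam B m σ a).precision 0 j.succ = -(m / (1 + ∑ j, a j ^ 2)) * a j := by
  set t := ∑ j, a j ^ 2 with ht
  have ht0 : 0 ≤ t := Finset.sum_nonneg fun j _ => sq_nonneg _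
  set S := (spikedParam B m σ a).cov with hS
  have hu : IsUnit S.det :=
    (Matrix.isUnit_iff_isUnit_det _).1 (posDef_spikedParam_cov B σ hm a).isUnit
  set e : Fin (d + 1) → ℝ := Pi.single 0 1 with he
  set b : Fin (d + 1) → ℝ := Fin.cons 0 a with hb
  -- The span of `e` and `b` is invariant under `S`, so row `0` of the inverse can be sought there;
  -- this solves the resulting two-by-two system.
  set w : Fin (d + 1) → ℝ := (1 + t / (1 + t)) • e - (m / (1 + t)) • b with hw
  have hbb : b ⬝ᵥ b = t := by rw [hb, cons_zero_dotProduct]; simp [ht, sq]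
  have hbe : b ⬝ᵥ e = 0 := by rw [he, dotProduct_single]; simp [hb]
  have heb : e ⬝ᵥ b = 0 := by rw [dotProduct_comm, hbe]
  have hee : e ⬝ᵥ e = 1 := by rw [he, dotProduct_single]; simp
  have hSdef : S = 1 + m • (Matrix.vecMulVec e b + Matrix.vecMulVec b e)
    + (2 : ℝ) • Matrix.vecMulVec b b := rfl
  have hwS : Matrix.vecMul w S = e := by
    rw [hSdef]
    simp only [Matrix.vecMul_add, Matrix.vecMul_smul, Matrix.vecMul_one, Matrix.vecMul_vecMulVec,
      hw, sub_dotProduct, smul_dotProduct, hbb, hbe, heb, hee, smul_eq_mul]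
    funext i
    have h1 : 1 + t ≠ 0 := by positivity
    simp only [Pi.add_apply, Pi.sub_apply, Pi.smul_apply, smul_eq_mul]
    field_simp
    linear_combination (-(t * e i)) * hm
  have hrow : Matrix.vecMul e S⁻¹ = w := by
    rw [← hwS, Matrix.vecMul_vecMul, Matrix.mul_nonsing_inv _ hu, Matrix.vecMul_one]
  have : S⁻¹ 0 j.succ = Matrix.vecMul e S⁻¹ j.succ := by
    rw [he, Matrix.single_one_vecMul, Matrix.row_apply]
  rw [Param.precision, this, hrow]
  simp [hw, he, hb]

/-! ### Characteristic functions and the law of a spiked observation -/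

theorem integral_cexp_gaussianReal (v : NNReal) (r : ℝ) :
    ∫ x, Complex.exp (((r * x : ℝ) : ℂ) * Complex.I) ∂(gaussianReal 0 v)
      = Complex.exp (-((v * r ^ 2 / 2 : ℝ) : ℂ)) := by
  have h := charFun_gaussianReal (μ := 0) (v := v) r
  rw [charFun_apply_real] at h
  push_cast
  rw [h]
  congr 1
  push_cast
  ring

theorem integral_cexp_pi_gaussianReal {d : ℕ} (r : Fin d → ℝ) :
    ∫ x, Complex.exp (((∑ j, r j * x j : ℝ) : ℂ) * Complex.I)
        ∂(Measure.pi fun _ : Fin d => gaussianReal 0 1)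
      = Complex.exp (-(((∑ j, r j ^ 2) / 2 : ℝ) : ℂ)) := by
  have h : ∀ x : Fin d → ℝ, Complex.exp (((∑ j, r j * x j : ℝ) : ℂ) * Complex.I)
      = ∏ j, Complex.exp (((r j * x j : ℝ) : ℂ) * Complex.I) := fun x => by
    rw [← Complex.exp_sum, Complex.ofReal_sum, Finset.sum_mul]
  simp_rw [h]
  rw [integral_fintype_prod_eq_prod (fun j (x : ℝ) => Complex.exp (((r j * x : ℝ) : ℂ) * Complex.I))]
  simp_rw [integral_cexp_gaussianReal]
  rw [← Complex.exp_sum]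
  congr 1
  push_cast
  rw [Finset.sum_neg_distrib, Finset.sum_div]
  simp

theorem integral_cexp_multivariateGaussian {N : ℕ} {S : Matrix (Fin N) (Fin N) ℝ}
    (hS : S.PosSemidef) (u : Fin N → ℝ) :
    ∫ x, Complex.exp (((∑ j, u j * x j : ℝ) : ℂ) * Complex.I)
        ∂(multivariateGaussian (0 : EuclideanSpace ℝ (Fin N)) S)
      = Complex.exp (-((u ⬝ᵥ (S.mulVec u) / 2 : ℝ) : ℂ)) := by
  have h := charFun_multivariateGaussian (μ := 0) hS (WithLp.toLp 2 u)
  rw [charFun_apply] at h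
  have h2 : ∀ x : EuclideanSpace ℝ (Fin N), inner ℝ x (WithLp.toLp 2 u) = ∑ j, u j * x j :=
    fun x => by simp [PiLp.inner_apply]
  simp_rw [h2] at h
  rw [h]
  congr 1
  simp

theorem strongDual_obs_apply {d : ℕ} (L : StrongDual ℝ (Obs d)) :
    ∃ (p q : ℝ) (r : Fin d → ℝ), ∀ y z w, L (y, z, w) = p * y + q * z + ∑ j, r j * w j := by
  refine ⟨L (1, 0, 0), L (0, 1, 0), fun j => L (0, 0, Pi.single j 1), fun y z w => ?_⟩
  have h1 : ((y, z, w) : Obs d) = y • ((1, 0, 0) : Obs d) + z • ((0, 1, 0) : Obs d)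
      + ∑ j, w j • ((0, 0, Pi.single j 1) : Obs d) := by
    have h2 : ∑ j, w j • ((0, 0, Pi.single j 1) : Obs d) = (0, 0, w) := by
      refine Prod.ext (by simp [Prod.fst_sum]) (Prod.ext (by simp [Prod.fst_sum, Prod.snd_sum]) ?_)
      funext i
      simp [Prod.snd_sum, Finset.sum_apply, Pi.single_apply]
    rw [h2]
    simp
  conv_lhs => rw [h1]
  simp only [map_add, map_sum, map_smul, smul_eq_mul]
  congr 1
  · ring
  · exact Finset.sum_congr rfl fun j _ => mul_comm _ _

/-- The law of the independent standard Gaussian variables `(z, e, ξ)`. -/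
noncomputable def baseLaw (d : ℕ) : Measure (Obs d) :=
  (gaussianReal 0 1).prod ((gaussianReal 0 1).prod (Measure.pi fun _ : Fin d => gaussianReal 0 1))

instance (d : ℕ) : IsProbabilityMeasure (baseLaw d) := by unfold baseLaw; infer_instance

/-- Given `z` and `W`, the best predictor of `e` is `⟨a, W - m z a⟩ / (1 + t)`, with residual
variance `1 / (1 + t)`; substituting it into `B z + σ e` gives the coefficients and noise level of
`spikedParam`. Both sides are centred Gaussian, so the proof compares the quadratic exponents of
their characteristic functions. -/
theorem obsLaw_spikedParam {d : ℕ} (B σ : ℝ) {m : ℝ} (hm : m ^ 2 = 1) (a : Fin d → ℝ) :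
    (spikedParam B m σ a).obsLaw = (baseLaw d).map
      fun q => (B * q.1 + σ * q.2.1, q.1, q.2.2 + (q.2.1 + m * q.1) • a) := by
  set t := ∑ j, a j ^ 2 with ht
  have ht0 : 0 ≤ t := Finset.sum_nonneg fun j _ => sq_nonneg _
  have hPS := (posDef_spikedParam_cov B σ hm a).posSemidef
  set θ := spikedParam B m σ a with hθ
  have hm1 : Measurable fun q : EuclideanSpace ℝ (Fin (d + 1)) × ℝ =>
      (q.1 0 * θ.beta + (∑ j : Fin d, q.1 j.succ * θ.gamma j) + q.2,
      q.1 0, fun j : Fin d => q.1 j.succ) := by fun_prop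
  have hm2 : Measurable fun q : Obs d =>
      (B * q.1 + σ * q.2.1, q.1, q.2.2 + (q.2.1 + m * q.1) • a) := by fun_prop
  have : IsProbabilityMeasure θ.obsLaw := Measure.isProbabilityMeasure_map hm1.aemeasurable
  have : IsProbabilityMeasure ((baseLaw d).map fun q =>
      (B * q.1 + σ * q.2.1, q.1, q.2.2 + (q.2.1 + m * q.1) • a)) :=
    Measure.isProbabilityMeasure_map hm2.aemeasurable
  refine Measure.ext_of_charFunDual (funext fun L => ?_)
  obtain ⟨p, q, r, hL⟩ := strongDual_obs_apply L
  have hmL : Measurable fun v : Obs d => Complex.exp ((L v : ℂ) * Complex.I) := by fun_prop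
  rw [charFunDual_apply, charFunDual_apply, Param.obsLaw,
    integral_map hm1.aemeasurable hmL.aestronglyMeasurable,
    integral_map hm2.aemeasurable hmL.aestronglyMeasurable]
  set x := ∑ j, r j * a j with hx
  -- The functional `(p, q, r)` on observations, pulled back to the covariates `X`; the noise keeps
  -- the coefficient `p`.
  set u : Fin (d + 1) → ℝ := Fin.cons (p * θ.beta + q) (fun j => p * θ.gamma j + r j) with hu
  have e1 : ∀ w : EuclideanSpace ℝ (Fin (d + 1)) × ℝ,
      Complex.exp ((L (w.1 0 * θ.beta + (∑ j : Fin d, w.1 j.succ * θ.gamma j) + w.2,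
        w.1 0, fun j : Fin d => w.1 j.succ) : ℂ) * Complex.I)
      = Complex.exp (((∑ j, u j * w.1 j : ℝ) : ℂ) * Complex.I)
        * Complex.exp (((p * w.2 : ℝ) : ℂ) * Complex.I) := fun w => by
    rw [← Complex.exp_add, ← add_mul, ← Complex.ofReal_add, hL]
    congr 3
    simp only [hu, Fin.sum_univ_succ, Fin.cons_zero, Fin.cons_succ, add_mul, Finset.sum_add_distrib,
      mul_add, Finset.mul_sum]
    have : ∀ j : Fin d, p * (w.1 j.succ * θ.gamma j) = p * θ.gamma j * w.1 j.succ :=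
      fun j => by ring
    simp_rw [this]
    ring
  have e2 : ∀ w : Obs d,
      Complex.exp ((L (B * w.1 + σ * w.2.1, w.1, w.2.2 + (w.2.1 + m * w.1) • a) : ℂ) * Complex.I)
      = Complex.exp ((((p * B + q + m * x) * w.1 : ℝ) : ℂ) * Complex.I)
        * (Complex.exp ((((p * σ + x) * w.2.1 : ℝ) : ℂ) * Complex.I)
          * Complex.exp (((∑ j, r j * w.2.2 j : ℝ) : ℂ) * Complex.I)) := fun w => by
    rw [← Complex.exp_add, ← Complex.exp_add, ← add_mul, ← add_mul, ← Complex.ofReal_add,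
      ← Complex.ofReal_add, hL]
    congr 3
    have : ∑ j, r j * (w.2.2 + (w.2.1 + m * w.1) • a) j
        = ∑ j, r j * w.2.2 j + (w.2.1 + m * w.1) * x := by
      rw [hx, Finset.mul_sum, ← Finset.sum_add_distrib]
      exact Finset.sum_congr rfl fun j _ => by simp; ring
    rw [this]
    ring
  simp_rw [e1, e2]
  rw [integral_prod_mul (f := fun v : EuclideanSpace ℝ (Fin (d + 1)) =>
      Complex.exp (((∑ j, u j * v j : ℝ) : ℂ) * Complex.I))
      (g := fun e : ℝ => Complex.exp (((p * e : ℝ) : ℂ) * Complex.I)), baseLaw, integral_prod_mul (f := fun z : ℝ =>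
      Complex.exp ((((p * B + q + m * x) * z : ℝ) : ℂ) * Complex.I))
      (g := fun w : ℝ × (Fin d → ℝ) => Complex.exp ((((p * σ + x) * w.1 : ℝ) : ℂ) * Complex.I)
          * Complex.exp (((∑ j, r j * w.2 j : ℝ) : ℂ) * Complex.I)), integral_prod_mul
      (f := fun e : ℝ => Complex.exp ((((p * σ + x) * e : ℝ) : ℂ) * Complex.I))
      (g := fun w : Fin d → ℝ => Complex.exp (((∑ j, r j * w j : ℝ) : ℂ) * Complex.I)),
    integral_cexp_multivariateGaussian hPS, integral_cexp_gaussianReal,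
    integral_cexp_gaussianReal, integral_cexp_gaussianReal, integral_cexp_pi_gaussianReal,
    ← Complex.exp_add, ← Complex.exp_add, ← Complex.exp_add]
  congr 1
  rw [← Complex.ofReal_neg, ← Complex.ofReal_neg, ← Complex.ofReal_neg, ← Complex.ofReal_neg,
    ← Complex.ofReal_neg, ← Complex.ofReal_add, ← Complex.ofReal_add, ← Complex.ofReal_add]
  congr 1
  have h1 : 1 + t ≠ 0 := by positivity
  have hg : ∀ j, θ.gamma j = σ / (1 + t) * a j := fun j => by
    simp only [hθ, spikedParam, ← ht]; ring
  have hau : ∑ j : Fin d, a j * u j.succ = p * σ / (1 + t) * t + x := by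
    simp only [hu, Fin.cons_succ, hg, hx, ht, mul_add, Finset.sum_add_distrib, Finset.mul_sum]
    congr 1 <;> exact Finset.sum_congr rfl fun j _ => by ring
  have huu : ∑ j : Fin d, u j.succ ^ 2
      = (p * σ / (1 + t)) ^ 2 * t + 2 * (p * σ / (1 + t)) * x + ∑ j, r j ^ 2 := by
    simp only [hu, Fin.cons_succ, hg]
    rw [hx]
    nth_rewrite 2 [ht]
    rw [Finset.mul_sum, Finset.mul_sum, ← Finset.sum_add_distrib, ← Finset.sum_add_distrib]
    exact Finset.sum_congr rfl fun j _ => by ring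
  have hσ : ((Real.toNNReal (θ.sigma ^ 2) : NNReal) : ℝ) = σ ^ 2 / (1 + t) := by
    rw [Real.coe_toNNReal _ (sq_nonneg _)]
    simp only [hθ, spikedParam, ← ht]
    rw [div_pow, Real.sq_sqrt (by positivity)]
  have hu0 : u 0 = p * (B - m * σ * t / (1 + t)) + q := rfl
  rw [hθ, dotProduct_spikedParam_cov, ← hθ, hau, huu, hσ, hu0, NNReal.coe_one]
  generalize ∑ j, r j ^ 2 = R
  field_simp
  ring_nf
  simp only [hm]
  ring

/-! ### Membership of the spiked parameters in the sparse space -/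

/-- At a unit eigenvector the quadratic form differs from `1` by `2 m v₀ x + 2 x²`, where `|x| ≤ η`
by Cauchy–Schwarz. -/
theorem spikedParam_eigenvalues_bound {d : ℕ} (B m σ : ℝ) (hm : m ^ 2 = 1) (a : Fin d → ℝ) {η M : ℝ}
    (hM : 1 < M) (hη0 : 0 ≤ η) (ht : ∑ j, a j ^ 2 ≤ η ^ 2) (hη : 2 * η + 2 * η ^ 2 ≤ 1 - M⁻¹)
    (i : Fin (d + 1)) :
    M⁻¹ ≤ (isHermitian_spikedParam_cov B m σ a).eigenvalues i ∧
      (isHermitian_spikedParam_cov B m σ a).eigenvalues i ≤ M := by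
  set hS := isHermitian_spikedParam_cov B m σ a
  have hv := hS.eigenvectorBasis.orthonormal.1 i
  have he := hS.eigenvalues_eq i
  set v := hS.eigenvectorBasis i
  rw [RCLike.re_to_real, star_trivial, dotProduct_spikedParam_cov] at he
  have hn : v 0 ^ 2 + ∑ j : Fin d, v j.succ ^ 2 = 1 := by
    have h := EuclideanSpace.norm_sq_eq v
    rw [hv, Fin.sum_univ_succ] at h
    simpa using h.symm
  have hcs : (∑ j, a j * v j.succ) ^ 2 ≤ (∑ j, a j ^ 2) * ∑ j : Fin d, v j.succ ^ 2 :=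
    Finset.sum_mul_sq_le_sq_mul_sq _ _ _
  set x := ∑ j, a j * v j.succ
  have h0 : 0 ≤ ∑ j : Fin d, v j.succ ^ 2 := Finset.sum_nonneg fun j _ => sq_nonneg _
  have h1 : ∑ j : Fin d, v j.succ ^ 2 ≤ 1 := by nlinarith [sq_nonneg (v 0)]
  have hx : x ^ 2 ≤ η ^ 2 := hcs.trans (by nlinarith [sq_nonneg η])
  have hxa : |x| ≤ η := abs_le_of_sq_le_sq hx hη0
  have hv0 : |v 0| ≤ 1 := abs_le_of_sq_le_sq (by nlinarith) zero_le_one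
  have hma : |m| = 1 := by
    have : |m| ^ 2 = 1 := by rw [sq_abs, hm]
    nlinarith [abs_nonneg m]
  have hp : |2 * m * v 0 * x| ≤ 2 * η := by
    rw [abs_mul, abs_mul, abs_mul, hma, abs_two]
    nlinarith [abs_nonneg x, abs_nonneg (v 0)]
  have hp' := abs_le.1 hp
  -- The gap below `1` is the smaller one, so a single smallness condition on `η` serves both
  -- bounds.
  have hMM : 1 - M⁻¹ ≤ M - 1 := by
    have h2 : M * M⁻¹ = 1 := mul_inv_cancel₀ (by positivity)
    have h3 : 0 < M⁻¹ := by positivity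
    nlinarith [mul_pos (sub_pos.2 hM) (sub_pos.2 hM), mul_pos h3 (mul_pos (sub_pos.2 hM) (sub_pos.2 hM))]
  rw [hn] at he
  constructor <;> nlinarith [sq_nonneg x]

theorem spikedParam_mem_sparseSpace {d : ℕ} {B m σ M M₁ M₂ η b : ℝ} {s : ℕ} {a : Fin d → ℝ}
    (hm : m ^ 2 = 1) (hM : 1 < M) (hM₂ : 0 ≤ M₂) (hσ : 0 ≤ σ) (hσ₁ : σ ≤ M₁)
    (hη0 : 0 ≤ η) (ht : ∑ j, a j ^ 2 ≤ η ^ 2) (hη : 2 * η + 2 * η ^ 2 ≤ 1 - M⁻¹)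
    (hb : B - m * σ * (∑ j, a j ^ 2) / (1 + ∑ j, a j ^ 2) = b)
    (hnorm : b ^ 2 + σ ^ 2 * (∑ j, a j ^ 2) / (1 + ∑ j, a j ^ 2) ^ 2 ≤ M₂ ^ 2)
    (hs : {j | a j ≠ 0}.ncard + 1 ≤ s) :
    spikedParam B m σ a ∈ sparseSpace d M M₁ M₂ s b := by
  have ht0 : 0 ≤ ∑ j, a j ^ 2 := Finset.sum_nonneg fun j _ => sq_nonneg _
  refine ⟨⟨⟨isHermitian_spikedParam_cov B m σ a,
    spikedParam_eigenvalues_bound B m σ hm a hM hη0 ht hη⟩, ?_, ?_, ?_⟩, hb, ?_⟩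
  · exact div_nonneg hσ (Real.sqrt_nonneg _)
  · refine (div_le_self hσ ?_).trans hσ₁
    rw [Real.one_le_sqrt]; linarith
  · rw [← abs_of_nonneg (norm_nonneg _)]
    refine abs_le_of_sq_le_sq ?_ hM₂
    rw [EuclideanSpace.norm_sq_eq, Fin.sum_univ_succ]
    refine le_trans (le_of_eq ?_) hnorm
    simp only [Param.coeff, Fin.cons_zero, Fin.cons_succ, Real.norm_eq_abs, sq_abs]
    congr 1
    · rw [← hb]; rfl
    · simp only [spikedParam, div_pow, mul_pow]
      rw [← Finset.sum_div, ← Finset.mul_sum]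
  -- The extra `1` in the count pays for the diagonal entry at index `0`.
  · refine le_trans ?_ hs
    have hsub : {j | (spikedParam B m σ a).precision 0 j ≠ 0}
        ⊆ insert 0 (Fin.succ '' {j | a j ≠ 0}) := by
      intro j
      refine Fin.cases (fun _ => Set.mem_insert _ _) (fun i hi => ?_) j
      refine Set.mem_insert_of_mem _ ⟨i, fun h => hi ?_, rfl⟩
      rw [spikedParam_precision_zero B σ hm, h, mul_zero]
    refine (Set.ncard_le_ncard hsub (Set.toFinite _)).trans ((Set.ncard_insert_le _ _).trans ?_)
    exact Nat.add_le_add_right (Set.ncard_image_le (Set.toFinite _)) 1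

/-! ### Second-moment method for `n` observations -/

/-- All laws are images under the same map `T`, so `ψ` can be pulled back and the densities compared
on the base space. Independence raises each pairwise second moment to the power `n`. -/
theorem abs_avg_expect_sub_le {d n : ℕ} {ι : Type*} [Fintype ι] [Nonempty ι]
    (θ₀ : Param d) (θ : ι → Param d) (P : Measure (Obs d)) [IsProbabilityMeasure P]
    (T : Obs d → Obs d) (hT : Measurable T) (g : ι → Obs d → ℝ) (hg : ∀ i, Measurable (g i))
    (hg0 : ∀ i x, 0 ≤ g i x) (h1 : ∀ i, ∫⁻ x, ENNReal.ofReal (g i x) ∂P = 1)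
    (hθ₀ : θ₀.obsLaw = P.map T)
    (hθ : ∀ i, (θ i).obsLaw = (P.withDensity fun x => ENNReal.ofReal (g i x)).map T)
    (K : ι → ι → ℝ) (hK0 : ∀ i j, 0 ≤ K i j)
    (hK : ∀ i j, ∫⁻ x, ENNReal.ofReal (g i x * g j x) ∂P ≤ ENNReal.ofReal (K i j))
    {α : ℝ} (hα : 0 < α)
    (hsum : ∑ i, ∑ j, K i j ^ n ≤ (1 + α ^ 2) * (Fintype.card ι : ℝ) ^ 2)
    (ψ : (Fin n → Obs d) → ℝ) (hψ : Measurable ψ) (hψ01 : ∀ x, 0 ≤ ψ x ∧ ψ x ≤ 1) :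
    |(∑ i, expect n (θ i) ψ) / Fintype.card ι - expect n θ₀ ψ| ≤ α := by
  have hTn : Measurable fun (x : Fin n → Obs d) k => T (x k) := by fun_prop
  have hprob : ∀ i, IsProbabilityMeasure (P.withDensity fun x => ENNReal.ofReal (g i x)) :=
    fun i => ⟨by rw [withDensity_apply _ MeasurableSet.univ, Measure.restrict_univ, h1]⟩
  have hmap : ∀ (ν : Measure (Obs d)) [IsProbabilityMeasure ν],
      Measure.pi (fun _ : Fin n => ν.map T)
        = (Measure.pi fun _ : Fin n => ν).map fun x k => T (x k) := fun ν _ =>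
    (Measure.pi_map_pi (μ := fun _ : Fin n => ν) (f := fun _ => T)
      fun _ => hT.aemeasurable).symm
  have e0 : expect n θ₀ ψ = ∫ x, ψ (fun k => T (x k)) ∂(Measure.pi fun _ : Fin n => P) := by
    rw [expect, Param.dataLaw]
    simp_rw [hθ₀]
    rw [hmap P, integral_map hTn.aemeasurable hψ.aestronglyMeasurable]
  have ei : ∀ i, expect n (θ i) ψ = ∫ x, ψ (fun k => T (x k))
      ∂((Measure.pi fun _ : Fin n => P).withDensity
        fun x => ENNReal.ofReal (∏ k, g i (x k))) := fun i => by
    rw [expect, Param.dataLaw]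
    simp_rw [hθ i]
    rw [hmap, integral_map hTn.aemeasurable hψ.aestronglyMeasurable,
      pi_withDensity (fun _ : Fin n => P) (fun _ x => ENNReal.ofReal (g i x))
        fun _ => (hg i).ennreal_ofReal]
    simp_rw [ENNReal.ofReal_prod_of_nonneg fun k _ => hg0 i _]
  simp_rw [e0, ei]
  refine abs_avg_sub_le_of_chiSq (Measure.pi fun _ : Fin n => P) (fun i x => ∏ k, g i (x k))
    (fun i => Finset.measurable_prod _ fun k _ => (hg i).comp (measurable_pi_apply k))
    (fun i x => Finset.prod_nonneg fun k _ => hg0 i _) (fun i => ?_) (fun i j => K i j ^ n)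
    (fun i j => pow_nonneg (hK0 i j) n) (fun i j => ?_) hα hsum
    (fun x => ψ fun k => T (x k)) (hψ.comp hTn) fun x => hψ01 _
  · simp_rw [ENNReal.ofReal_prod_of_nonneg fun k _ => hg0 i _]
    rw [lintegral_pi_prod (fun _ : Fin n => P) (fun _ x => ENNReal.ofReal (g i x))
      fun _ => (hg i).ennreal_ofReal]
    simp [h1]
  · simp_rw [← Finset.prod_mul_distrib,
      ENNReal.ofReal_prod_of_nonneg fun k _ => mul_nonneg (hg0 i _) (hg0 j _)]
    rw [lintegral_pi_prod (fun _ : Fin n => P) (fun _ x => ENNReal.ofReal (g i x * g j x))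
      fun _ => ((hg i).mul (hg j)).ennreal_ofReal, ENNReal.ofReal_pow (hK0 i j),
      Finset.prod_const, Finset.card_univ, Fintype.card_fin]
    exact pow_le_pow_left' (hK i j) n

/-! ### Likelihood ratio of a spike -/

/-- Likelihood ratio of `(z, e, ξ + (e + m z) a)` with respect to `(z, e, ξ)`. -/
noncomputable def spikeDensity {d : ℕ} (m : ℝ) (a : Fin d → ℝ) (q : Obs d) : ℝ :=
  Real.exp ((q.2.1 + m * q.1) * (∑ j, a j * q.2.2 j)
    - (q.2.1 + m * q.1) ^ 2 * (∑ j, a j ^ 2) / 2)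

theorem measurable_spikeDensity {d : ℕ} (m : ℝ) (a : Fin d → ℝ) :
    Measurable (spikeDensity m a) := by
  unfold spikeDensity; fun_prop

theorem map_add_smul_pi_gaussianReal {d : ℕ} (l : ℝ) (a : Fin d → ℝ) :
    (Measure.pi fun _ : Fin d => gaussianReal 0 1).map (fun x => x + l • a)
      = (Measure.pi fun _ : Fin d => gaussianReal 0 1).withDensity
        fun x => ENNReal.ofReal (Real.exp (l * (∑ i, a i * x i) - l ^ 2 * (∑ i, a i ^ 2) / 2)) := by
  rw [map_add_pi_gaussianReal]
  simp only [Pi.smul_apply, smul_eq_mul, mul_pow, mul_assoc, Finset.mul_sum]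

theorem lintegral_eq_one_of_eq_withDensity {X : Type*} [MeasurableSpace X] {μ ν : Measure X}
    [IsProbabilityMeasure ν] {f : X → ENNReal} (h : ν = μ.withDensity f) : ∫⁻ x, f x ∂μ = 1 := by
  have h1 : ν Set.univ = μ.withDensity f Set.univ := by rw [← h]
  rw [measure_univ, withDensity_apply _ MeasurableSet.univ, Measure.restrict_univ] at h1
  exact h1.symm

theorem lintegral_exp_linear_pi_gaussianReal {d : ℕ} (l : ℝ) (a : Fin d → ℝ) :
    ∫⁻ x, ENNReal.ofReal (Real.exp (l * (∑ i, a i * x i) - l ^ 2 * (∑ i, a i ^ 2) / 2))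
      ∂(Measure.pi fun _ : Fin d => gaussianReal 0 1) = 1 := by
  have := Measure.isProbabilityMeasure_map (μ := Measure.pi fun _ : Fin d => gaussianReal 0 1) (f := fun x => x + l • a) (by fun_prop)
  exact lintegral_eq_one_of_eq_withDensity (map_add_smul_pi_gaussianReal l a)

theorem baseLaw_map_spike {d : ℕ} (m : ℝ) (a : Fin d → ℝ) :
    (baseLaw d).map (fun q => (q.1, q.2.1, q.2.2 + (q.2.1 + m * q.1) • a))
      = (baseLaw d).withDensity fun q => ENNReal.ofReal (spikeDensity m a q) := by
  refine map_prod_fiberwise (gaussianReal 0 1)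
    ((gaussianReal 0 1).prod (Measure.pi fun _ : Fin d => gaussianReal 0 1))
    (fun z w => (w.1, w.2 + (w.1 + m * z) • a))
    (fun z w => ENNReal.ofReal (spikeDensity m a (z, w)))
    (by unfold Function.uncurry; fun_prop) ((measurable_spikeDensity m a).ennreal_ofReal)
    fun z => ?_
  exact map_prod_fiberwise (gaussianReal 0 1) (Measure.pi fun _ : Fin d => gaussianReal 0 1)
    (fun e x => x + (e + m * z) • a)
    (fun e x => ENNReal.ofReal (spikeDensity m a (z, e, x)))
    (by unfold Function.uncurry; fun_prop)
    (((measurable_spikeDensity m a).comp measurable_prodMk_left).ennreal_ofReal)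
    fun e => map_add_smul_pi_gaussianReal (e + m * z) a

theorem lintegral_spikeDensity {d : ℕ} (m : ℝ) (a : Fin d → ℝ) :
    ∫⁻ q, ENNReal.ofReal (spikeDensity m a q) ∂(baseLaw d) = 1 := by
  have := Measure.isProbabilityMeasure_map (μ := baseLaw d) (f := fun q => (q.1, q.2.1, q.2.2 + (q.2.1 + m * q.1) • a)) (by fun_prop)
  exact lintegral_eq_one_of_eq_withDensity (baseLaw_map_spike m a)

/-- Integrating out `ξ` leaves exactly `exp ((e + m z)² y)`: the product of the two shifts is the
shift by `a + b` up to the cross term. Then `(e + m z)² ≤ 2 e² + 2 z²` separates the variables, and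
each of the two Gaussian integrals, with parameter `2 y ≤ 1 / 4`, costs `exp (4 y)`. -/
theorem lintegral_spikeDensity_mul_le {d : ℕ} {m : ℝ} (hm : m ^ 2 = 1) (a b : Fin d → ℝ) {y : ℝ}
    (hy : ∑ j, a j * b j = y) (hy0 : 0 ≤ y) (hy1 : y ≤ 1 / 8) :
    ∫⁻ q, ENNReal.ofReal (spikeDensity m a q * spikeDensity m b q) ∂(baseLaw d)
      ≤ ENNReal.ofReal (Real.exp (8 * y)) := by
  have hmeas : Measurable fun q : Obs d =>
      ENNReal.ofReal (spikeDensity m a q * spikeDensity m b q) :=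
    ((measurable_spikeDensity m a).mul (measurable_spikeDensity m b)).ennreal_ofReal
  have hinner : ∀ z e : ℝ, ∫⁻ x, ENNReal.ofReal
      (spikeDensity m a (z, e, x) * spikeDensity m b (z, e, x))
        ∂(Measure.pi fun _ : Fin d => gaussianReal 0 1)
      = ENNReal.ofReal (Real.exp ((e + m * z) ^ 2 * y)) := fun z e => by
    have h : ∀ x : Fin d → ℝ, ENNReal.ofReal
        (spikeDensity m a (z, e, x) * spikeDensity m b (z, e, x))
        = ENNReal.ofReal (Real.exp ((e + m * z) ^ 2 * y))
          * ENNReal.ofReal (Real.exp ((e + m * z) * (∑ i, (a + b) i * x i)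
            - (e + m * z) ^ 2 * (∑ i, (a + b) i ^ 2) / 2)) := fun x => by
      rw [← ENNReal.ofReal_mul (Real.exp_pos _).le, ← Real.exp_add, spikeDensity, spikeDensity,
        ← Real.exp_add]
      congr 2
      have h1 : ∑ i, (a + b) i * x i = ∑ i, a i * x i + ∑ i, b i * x i := by
        simp only [Pi.add_apply, add_mul, Finset.sum_add_distrib]
      have h2 : ∑ i, (a + b) i ^ 2 = ∑ i, a i ^ 2 + ∑ i, b i ^ 2 + 2 * y := by
        rw [← hy, Finset.mul_sum, ← Finset.sum_add_distrib, ← Finset.sum_add_distrib]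
        exact Finset.sum_congr rfl fun i _ => by simp only [Pi.add_apply]; ring
      rw [h1, h2]
      ring
    simp_rw [h]
    rw [lintegral_const_mul _ (by fun_prop), lintegral_exp_linear_pi_gaussianReal, mul_one]
  rw [baseLaw, lintegral_prod _ hmeas.aemeasurable]
  have hbound : ∀ z : ℝ, ∫⁻ w, ENNReal.ofReal (spikeDensity m a (z, w) * spikeDensity m b (z, w))
      ∂((gaussianReal 0 1).prod (Measure.pi fun _ : Fin d => gaussianReal 0 1))
      ≤ ENNReal.ofReal (Real.exp (2 * y * z ^ 2)) * ENNReal.ofReal (Real.exp (4 * y)) := fun z => by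
    have hz : Measurable fun w =>
        ENNReal.ofReal (spikeDensity m a (z, w) * spikeDensity m b (z, w)) :=
      hmeas.comp measurable_prodMk_left
    rw [lintegral_prod _ hz.aemeasurable]
    simp_rw [hinner]
    have hle : ∀ e : ℝ, ENNReal.ofReal (Real.exp ((e + m * z) ^ 2 * y))
        ≤ ENNReal.ofReal (Real.exp (2 * y * z ^ 2))
          * ENNReal.ofReal (Real.exp (2 * y * e ^ 2)) := fun e => by
      rw [← ENNReal.ofReal_mul (Real.exp_pos _).le, ← Real.exp_add]
      refine ENNReal.ofReal_le_ofReal (Real.exp_le_exp.2 ?_)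
      have h1 : (e + m * z) ^ 2 ≤ 2 * e ^ 2 + 2 * z ^ 2 := by
        have : (m * z) ^ 2 = z ^ 2 := by rw [mul_pow, hm, one_mul]
        nlinarith [sq_nonneg (e - m * z)]
      nlinarith
    refine (lintegral_mono hle).trans ?_
    rw [lintegral_const_mul _ (by fun_prop)]
    gcongr
    refine (lintegral_exp_sq_gaussianReal_le (by linarith) (by linarith)).trans ?_
    rw [show 2 * (2 * y) = 4 * y by ring]
  refine (lintegral_mono hbound).trans ?_
  rw [lintegral_mul_const _ (by fun_prop)]
  refine (mul_le_mul_left (lintegral_exp_sq_gaussianReal_le (y := 2 * y) (by linarith)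
    (by linarith)) _).trans ?_
  rw [← ENNReal.ofReal_mul (Real.exp_pos _).le, ← Real.exp_add]
  refine ENNReal.ofReal_le_ofReal (Real.exp_le_exp.2 (by linarith))

theorem obsLaw_spikedParam_eq_withDensity {d : ℕ} (B σ : ℝ) {m : ℝ} (hm : m ^ 2 = 1)
    (a : Fin d → ℝ) :
    (spikedParam B m σ a).obsLaw
      = ((baseLaw d).withDensity fun q => ENNReal.ofReal (spikeDensity m a q)).map
        fun q => (B * q.1 + σ * q.2.1, q.1, q.2.2) := by
  rw [obsLaw_spikedParam B σ hm a, ← baseLaw_map_spike,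
    Measure.map_map (by fun_prop) (by fun_prop)]
  rfl

theorem obsLaw_spikedParam_zero {d : ℕ} (B σ : ℝ) {m : ℝ} (hm : m ^ 2 = 1) :
    (spikedParam B m σ (0 : Fin d → ℝ)).obsLaw
      = (baseLaw d).map fun q => (B * q.1 + σ * q.2.1, q.1, q.2.2) := by
  rw [obsLaw_spikedParam B σ hm]
  simp

/-! ### Likelihood ratio of a parametric shift of `β` -/

/-- Likelihood ratio of `(z, e + κ z, ξ)` with respect to `(z, e, ξ)`. -/
noncomputable def tiltDensity {d : ℕ} (κ : ℝ) (q : Obs d) : ℝ :=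
  Real.exp (κ * q.1 * q.2.1 - (κ * q.1) ^ 2 / 2)

theorem measurable_tiltDensity {d : ℕ} (κ : ℝ) : Measurable (tiltDensity (d := d) κ) := by
  unfold tiltDensity; fun_prop

theorem gaussianReal_map_add_eq_withDensity (c : ℝ) :
    (gaussianReal 0 1).map (fun x => x + c) = (gaussianReal 0 1).withDensity
      fun x => ENNReal.ofReal (Real.exp (c * x - c ^ 2 / 2)) := by
  rw [gaussianReal_map_add_const, zero_add, gaussianReal_eq_withDensity]

theorem baseLaw_map_tilt {d : ℕ} (κ : ℝ) :
    (baseLaw d).map (fun q => (q.1, q.2.1 + κ * q.1, q.2.2))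
      = (baseLaw d).withDensity fun q => ENNReal.ofReal (tiltDensity κ q) := by
  refine map_prod_fiberwise (gaussianReal 0 1)
    ((gaussianReal 0 1).prod (Measure.pi fun _ : Fin d => gaussianReal 0 1))
    (fun z w => (w.1 + κ * z, w.2))
    (fun z w => ENNReal.ofReal (tiltDensity κ (z, w)))
    (by unfold Function.uncurry; fun_prop) ((measurable_tiltDensity κ).ennreal_ofReal)
    fun z => ?_
  have h := Measure.map_prod_map (gaussianReal 0 1) (Measure.pi fun _ : Fin d => gaussianReal 0 1)
    (f := fun x : ℝ => x + κ * z) (g := id) (by fun_prop) measurable_id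
  rw [Measure.map_id, gaussianReal_map_add_eq_withDensity, prod_withDensity_left (by fun_prop)] at h
  exact h.symm

theorem lintegral_gaussianReal_tilt (c : ℝ) :
    ∫⁻ x, ENNReal.ofReal (Real.exp (c * x - c ^ 2 / 2)) ∂(gaussianReal 0 1) = 1 := by
  exact lintegral_eq_one_of_eq_withDensity (gaussianReal_eq_withDensity c)

theorem lintegral_tiltDensity {d : ℕ} (κ : ℝ) :
    ∫⁻ q, ENNReal.ofReal (tiltDensity κ q) ∂(baseLaw d) = 1 := by
  have := Measure.isProbabilityMeasure_map (μ := baseLaw d) (f := fun q => (q.1, q.2.1 + κ * q.1, q.2.2)) (by fun_prop)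
  exact lintegral_eq_one_of_eq_withDensity (baseLaw_map_tilt (d := d) κ)

/-- For fixed `z` the squared density is `exp (κ² z²)` times a Gaussian shift density in `e`, which
integrates to one. -/
theorem lintegral_tiltDensity_sq_le {d : ℕ} {κ : ℝ} (hκ : κ ^ 2 ≤ 1 / 4) :
    ∫⁻ q, ENNReal.ofReal (tiltDensity κ q * tiltDensity κ q) ∂(baseLaw d)
      ≤ ENNReal.ofReal (Real.exp (2 * κ ^ 2)) := by
  have hmeas : Measurable fun q : Obs d =>
      ENNReal.ofReal (tiltDensity κ q * tiltDensity κ q) :=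
    ((measurable_tiltDensity κ).mul (measurable_tiltDensity κ)).ennreal_ofReal
  rw [baseLaw, lintegral_prod _ hmeas.aemeasurable]
  refine le_trans (le_of_eq (lintegral_congr fun z => ?_))
    (lintegral_exp_sq_gaussianReal_le (sq_nonneg κ) hκ)
  have hz : Measurable fun w : ℝ × (Fin d → ℝ) =>
      ENNReal.ofReal (tiltDensity κ (z, w) * tiltDensity κ (z, w)) :=
    hmeas.comp measurable_prodMk_left
  rw [lintegral_prod _ hz.aemeasurable]
  have h : ∀ (e : ℝ) (x : Fin d → ℝ), ENNReal.ofReal (tiltDensity κ (z, e, x)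
      * tiltDensity κ (z, e, x)) = ENNReal.ofReal (Real.exp (κ ^ 2 * z ^ 2))
        * ENNReal.ofReal (Real.exp (2 * κ * z * e - (2 * κ * z) ^ 2 / 2)) := fun e x => by
    rw [← ENNReal.ofReal_mul (Real.exp_pos _).le, ← Real.exp_add, tiltDensity,
      ← Real.exp_add]
    congr 2
    simp only
    ring
  simp_rw [h]
  simp only [lintegral_const, measure_univ, mul_one]
  rw [lintegral_const_mul _ (by fun_prop), lintegral_gaussianReal_tilt, mul_one]

/-- The change of `β` is absorbed by the noise: `(B + h) z + σ e = B z + σ (e + (h / σ) z)`. -/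
theorem obsLaw_spikedParam_zero_eq_withDensity {d : ℕ} (B h : ℝ) {m σ : ℝ} (hm : m ^ 2 = 1)
    (hσ : σ ≠ 0) :
    (spikedParam (B + h) m σ (0 : Fin d → ℝ)).obsLaw
      = ((baseLaw d).withDensity fun q => ENNReal.ofReal (tiltDensity (h / σ) q)).map
        fun q => (B * q.1 + σ * q.2.1, q.1, q.2.2) := by
  rw [obsLaw_spikedParam_zero _ σ hm, ← baseLaw_map_tilt,
    Measure.map_map (by fun_prop) (by fun_prop)]
  congr 1
  funext q
  simp only [Function.comp_apply]
  congr 1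
  field_simp
  ring

/-! ### Random block vectors and their overlaps -/

/-- The vector with value `ρ` at the places `e (i, f i)`: one entry chosen in each block. -/
noncomputable def blockVec {k q d : ℕ} (e : Fin k × Fin q → Fin d) (ρ : ℝ) (f : Fin k → Fin q) :
    Fin d → ℝ :=
  fun j => ∑ i, if e (i, f i) = j then ρ else 0

/-- Injectivity of `e` makes the blocks disjoint, so only blocks where both choices agree
contribute. -/
theorem sum_blockVec_mul {k q d : ℕ} {e : Fin k × Fin q → Fin d} (he : Function.Injective e)
    (ρ : ℝ) (f g : Fin k → Fin q) :
    ∑ j, blockVec e ρ f j * blockVec e ρ g j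
      = ρ ^ 2 * ∑ i, if f i = g i then (1 : ℝ) else 0 := by
  simp only [blockVec, Finset.sum_mul_sum]
  rw [Finset.sum_comm, Finset.mul_sum]
  refine Finset.sum_congr rfl fun i _ => ?_
  rw [Finset.sum_comm]
  have : ∀ i', ∑ j, ((if e (i, f i) = j then ρ else 0) * if e (i', g i') = j then ρ else 0)
      = if i' = i then ρ ^ 2 * (if f i = g i then (1 : ℝ) else 0) else 0 := fun i' => by
    simp only [ite_mul, zero_mul, Finset.sum_ite_eq, Finset.mem_univ, if_true]
    simp only [he.eq_iff, Prod.mk.injEq]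
    by_cases h1 : i' = i
    · subst h1
      by_cases h2 : f i' = g i'
      · simp [h2, sq]
      · simp [h2, Ne.symm h2]
    · simp [h1]
  simp_rw [this]
  simp

theorem sum_blockVec_sq {k q d : ℕ} {e : Fin k × Fin q → Fin d} (he : Function.Injective e)
    (ρ : ℝ) (f : Fin k → Fin q) : ∑ j, blockVec e ρ f j ^ 2 = k * ρ ^ 2 := by
  have h := sum_blockVec_mul he ρ f f
  simp only [if_true, Finset.sum_const, Finset.card_univ, Fintype.card_fin, nsmul_eq_mul,
    mul_one] at h
  simp only [sq (blockVec e ρ f _)]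
  rw [h, mul_comm]

theorem ncard_support_blockVec_le {k q d : ℕ} (e : Fin k × Fin q → Fin d)
    (ρ : ℝ) (f : Fin k → Fin q) : {j | blockVec e ρ f j ≠ 0}.ncard ≤ k := by
  have hsub : {j | blockVec e ρ f j ≠ 0} ⊆ Set.range fun i => e (i, f i) := by
    intro j hj
    by_contra hne
    refine hj (Finset.sum_eq_zero fun i _ => if_neg fun h => hne ⟨i, h⟩)
  refine (Set.ncard_le_ncard hsub (Set.toFinite _)).trans ?_
  rw [← Set.image_univ]
  refine (Set.ncard_image_le (Set.toFinite _)).trans ?_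
  simp [Set.ncard_univ]

/-- The sum over `g` factorises over blocks. In each block one choice agrees, giving at most `q +
exp l ≤ q * exp (exp l / q)`. -/
theorem sum_exp_agreement_le {k q : ℕ} (hq : 0 < q) {l : ℝ} (f : Fin k → Fin q) :
    ∑ g : Fin k → Fin q, Real.exp (l * ∑ i, if f i = g i then (1 : ℝ) else 0)
      ≤ (q : ℝ) ^ k * Real.exp (k * (Real.exp l / q)) := by
  have hq' : (0 : ℝ) < q := by exact_mod_cast hq
  have h : ∀ g : Fin k → Fin q, Real.exp (l * ∑ i, if f i = g i then (1 : ℝ) else 0)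
      = ∏ i, Real.exp (l * if f i = g i then (1 : ℝ) else 0) := fun g => by
    rw [Finset.mul_sum, Real.exp_sum]
  simp_rw [h]
  have hpi := Finset.prod_univ_sum (fun _ : Fin k => (Finset.univ : Finset (Fin q)))
    (fun i j => Real.exp (l * if f i = j then (1 : ℝ) else 0))
  rw [Fintype.piFinset_univ] at hpi
  rw [← hpi]
  have hle : ∀ i, ∑ j, Real.exp (l * if f i = j then (1 : ℝ) else 0)
      ≤ q * Real.exp (Real.exp l / q) := fun i => by
    have h1 : ∀ j, Real.exp (l * if f i = j then (1 : ℝ) else 0)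
        ≤ 1 + if f i = j then Real.exp l else 0 := fun j => by
      split_ifs
      · simp
      · simp
    refine (Finset.sum_le_sum fun j _ => h1 j).trans ?_
    rw [Finset.sum_add_distrib]
    simp only [Finset.sum_const, Finset.card_univ, Fintype.card_fin, nsmul_eq_mul, mul_one,
      Finset.sum_ite_eq, Finset.mem_univ, if_true]
    have h2 := Real.add_one_le_exp (Real.exp l / q)
    have h3 : (q : ℝ) + Real.exp l = q * (Real.exp l / q + 1) := by field_simp; ring
    rw [h3]
    gcongr
  refine (Finset.prod_le_prod (fun i _ => Finset.sum_nonneg fun j _ => (Real.exp_pos _).le)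
    fun i _ => hle i).trans ?_
  rw [Finset.prod_const, Finset.card_univ, Fintype.card_fin, mul_pow, ← Real.exp_nat_mul]

/-! ### From indistinguishable mixtures to minimax power -/

theorem minimaxPower_le {d n : ℕ} {α x : ℝ} {T₀ T₁ : Set (Param d)}
    (h : ∀ ψ ∈ levelTests n α T₀, ∃ θ ∈ T₁, expect n θ ψ ≤ x) :
    minimaxPower n α T₀ T₁ ≤ (x : EReal) := by
  refine iSup₂_le fun ψ hψ => ?_
  obtain ⟨θ, hθ, hle⟩ := h ψ hψ
  exact iInf₂_le_of_le θ hθ (EReal.coe_le_coe_iff.2 hle)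

/-- Some member of the mixture has power at most the average, which is at most the level `α` plus
the discrepancy `α`. -/
theorem minimaxPower_le_of_mixture_alternative {d n : ℕ} {α : ℝ} {T₀ T₁ : Set (Param d)}
    {ι : Type*} [Fintype ι] [Nonempty ι] (θ₀ : Param d) (θ : ι → Param d) (h₀ : θ₀ ∈ T₀)
    (h₁ : ∀ i, θ i ∈ T₁)
    (h : ∀ ψ : (Fin n → Obs d) → ℝ, Measurable ψ → (∀ x, 0 ≤ ψ x ∧ ψ x ≤ 1) →
      |(∑ i, expect n (θ i) ψ) / Fintype.card ι - expect n θ₀ ψ| ≤ α) :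
    minimaxPower n α T₀ T₁ ≤ ((2 * α : ℝ) : EReal) := by
  refine minimaxPower_le fun ψ hψ => ?_
  have h1 := (abs_le.1 (h ψ hψ.1 hψ.2.1)).2
  have h2 := hψ.2.2 θ₀ h₀
  have hc : (0 : ℝ) < Fintype.card ι := by exact_mod_cast Fintype.card_pos
  by_contra! hcon
  have h3 : ∑ i, expect n (θ i) ψ ≤ 2 * α * Fintype.card ι := by
    rw [← div_le_iff₀ hc]; linarith
  have h4 : ∑ _i : ι, 2 * α < ∑ i, expect n (θ i) ψ :=
    Finset.sum_lt_sum_of_nonempty Finset.univ_nonempty fun i _ => hcon (θ i) (h₁ i)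
  rw [Finset.sum_const, Finset.card_univ, nsmul_eq_mul] at h4
  linarith

/-- The level constraint passes to the average over the null points, so the single alternative
already has small power. -/
theorem minimaxPower_le_of_mixture_null {d n : ℕ} {α : ℝ} {T₀ T₁ : Set (Param d)}
    {ι : Type*} [Fintype ι] [Nonempty ι] (θ₁ : Param d) (θ : ι → Param d) (h₁ : θ₁ ∈ T₁)
    (h₀ : ∀ i, θ i ∈ T₀)
    (h : ∀ ψ : (Fin n → Obs d) → ℝ, Measurable ψ → (∀ x, 0 ≤ ψ x ∧ ψ x ≤ 1) →
      |(∑ i, expect n (θ i) ψ) / Fintype.card ι - expect n θ₁ ψ| ≤ α) :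
    minimaxPower n α T₀ T₁ ≤ ((2 * α : ℝ) : EReal) := by
  refine minimaxPower_le fun ψ hψ => ⟨θ₁, h₁, ?_⟩
  have h1 := (abs_le.1 (h ψ hψ.1 hψ.2.1)).1
  have hc : (0 : ℝ) < Fintype.card ι := by exact_mod_cast Fintype.card_pos
  have h2 : (∑ i, expect n (θ i) ψ) / Fintype.card ι ≤ α := by
    rw [div_le_iff₀ hc]
    refine (Finset.sum_le_sum fun i _ => hψ.2.2 (θ i) (h₀ i)).trans ?_
    rw [Finset.sum_const, Finset.card_univ, nsmul_eq_mul, mul_comm]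
  linarith

/-! ### Lower bounds in the parametric and the sparse regime -/

theorem minimaxPower_le_of_parametric_gap {d n s : ℕ} {α M M₁ M₂ σ b h : ℝ} (hα : 0 < α)
    (hM : 1 < M) (hM₂ : 0 ≤ M₂) (hσ : 0 < σ) (hσ₁ : σ ≤ M₁) (hs : 1 ≤ s) (hb : |b| ≤ M₂)
    (hbh : |b + h| ≤ M₂) (hκ : (h / σ) ^ 2 ≤ 1 / 4)
    (hn : n * (2 * (h / σ) ^ 2) ≤ Real.log (1 + α ^ 2)) :
    minimaxPower n α (sparseSpace d M M₁ M₂ s b) (sparseSpace d M M₁ M₂ s (b + h))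
      ≤ ((2 * α : ℝ) : EReal) := by
  have hmem : ∀ b' : ℝ, |b'| ≤ M₂ →
      spikedParam b' 1 σ (0 : Fin d → ℝ) ∈ sparseSpace d M M₁ M₂ s b' := fun b' hb' => by
    refine spikedParam_mem_sparseSpace (η := 0) (one_pow 2) hM hM₂ hσ.le hσ₁ le_rfl (by simp) ?_
      (by simp) ?_ (by simpa using hs)
    · have := inv_le_one_of_one_le₀ hM.le
      linarith
    · simpa using sq_le_sq.2 (hb'.trans (le_abs_self M₂))
  refine minimaxPower_le_of_mixture_alternative (ι := Unit) (spikedParam b 1 σ 0)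
    (fun _ => spikedParam (b + h) 1 σ 0) (hmem b hb) (fun _ => hmem _ hbh) fun ψ hψ hψ01 => ?_
  refine abs_avg_expect_sub_le _ _ (baseLaw d) (fun q => (b * q.1 + σ * q.2.1, q.1, q.2.2))
    (by fun_prop) (fun _ => tiltDensity (h / σ)) (fun _ => measurable_tiltDensity _)
    (fun _ x => (Real.exp_pos _).le) (fun _ => lintegral_tiltDensity _)
    (obsLaw_spikedParam_zero b σ (one_pow 2))
    (fun _ => obsLaw_spikedParam_zero_eq_withDensity b h (one_pow 2) hσ.ne')
    (fun _ _ => Real.exp (2 * (h / σ) ^ 2)) (fun _ _ => (Real.exp_pos _).le)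
    (fun _ _ => lintegral_tiltDensity_sq_le hκ) hα ?_ ψ hψ hψ01
  simp only [Finset.univ_unique, Finset.sum_const, Finset.card_singleton, one_smul,
    Fintype.card_unit, Nat.cast_one, one_pow, mul_one]
  rw [← Real.exp_nat_mul, ← Real.le_log_iff_exp_le (by positivity)]
  exact hn

/-- The unspiked point sits at `B` and the mixture at `b`. The discrepancy bound is symmetric, so
either side can serve as the null. -/
theorem minimaxPower_le_of_blocks {d n s k q : ℕ} {α M M₁ M₂ σ m ρ η B b : ℝ} (hα : 0 < α)
    (hM : 1 < M) (hM₂ : 0 ≤ M₂) (hσ : 0 ≤ σ) (hσ₁ : σ ≤ M₁) (hm : m ^ 2 = 1)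
    (hq : 0 < q) (hkq : k * q ≤ d) (hks : k + 1 ≤ s) (hη0 : 0 ≤ η)
    (hη : 2 * η + 2 * η ^ 2 ≤ 1 - M⁻¹) (ht : k * ρ ^ 2 ≤ η ^ 2) (ht' : k * ρ ^ 2 ≤ 1 / 8)
    (hB : |B| ≤ M₂) (hb : B - m * σ * (k * ρ ^ 2) / (1 + k * ρ ^ 2) = b)
    (hnorm : b ^ 2 + σ ^ 2 * (k * ρ ^ 2) / (1 + k * ρ ^ 2) ^ 2 ≤ M₂ ^ 2)
    (hchi : k * (Real.exp (n * (8 * ρ ^ 2)) / q) ≤ Real.log (1 + α ^ 2)) :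
    minimaxPower n α (sparseSpace d M M₁ M₂ s B) (sparseSpace d M M₁ M₂ s b)
        ≤ ((2 * α : ℝ) : EReal) ∧
      minimaxPower n α (sparseSpace d M M₁ M₂ s b) (sparseSpace d M M₁ M₂ s B)
        ≤ ((2 * α : ℝ) : EReal) := by
  have : Nonempty (Fin q) := ⟨⟨0, hq⟩⟩
  set e : Fin k × Fin q → Fin d := fun x => Fin.castLE hkq (finProdFinEquiv x) with he
  have hinj : Function.Injective e :=
    (Fin.castLE_injective hkq).comp finProdFinEquiv.injective
  have hmem₀ : spikedParam B m σ (0 : Fin d → ℝ) ∈ sparseSpace d M M₁ M₂ s B :=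
    spikedParam_mem_sparseSpace hm hM hM₂ hσ hσ₁ hη0 (by simpa using sq_nonneg η) hη (by simp)
      (by simpa using sq_le_sq.2 (hB.trans (le_abs_self M₂))) (by simp; omega)
  have hmem : ∀ f : Fin k → Fin q,
      spikedParam B m σ (blockVec e ρ f) ∈ sparseSpace d M M₁ M₂ s b := fun f => by
    have hsum := sum_blockVec_sq hinj ρ f
    exact spikedParam_mem_sparseSpace hm hM hM₂ hσ hσ₁ hη0 (by rwa [hsum]) hη (by rwa [hsum])
      (by rwa [hsum]) ((Nat.add_le_add_right (ncard_support_blockVec_le e ρ f) 1).trans hks)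
  have key : ∀ ψ : (Fin n → Obs d) → ℝ, Measurable ψ → (∀ x, 0 ≤ ψ x ∧ ψ x ≤ 1) →
      |(∑ f : Fin k → Fin q, expect n (spikedParam B m σ (blockVec e ρ f)) ψ)
        / Fintype.card (Fin k → Fin q) - expect n (spikedParam B m σ 0) ψ| ≤ α := by
    intro ψ hψ hψ01
    refine abs_avg_expect_sub_le _ _ (baseLaw d) (fun q => (B * q.1 + σ * q.2.1, q.1, q.2.2))
      (by fun_prop) (fun f => spikeDensity m (blockVec e ρ f))
      (fun _ => measurable_spikeDensity _ _)
      (fun _ x => (Real.exp_pos _).le) (fun _ => lintegral_spikeDensity _ _)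
      (obsLaw_spikedParam_zero B σ hm)
      (fun _ => obsLaw_spikedParam_eq_withDensity B σ hm _)
      (fun f g => Real.exp (8 * (ρ ^ 2 * ∑ i, if f i = g i then (1 : ℝ) else 0)))
      (fun _ _ => (Real.exp_pos _).le)
      (fun f g => lintegral_spikeDensity_mul_le hm _ _ (sum_blockVec_mul hinj ρ f g) ?_ ?_) hα ?_
      ψ hψ hψ01
    · exact mul_nonneg (sq_nonneg _) (Finset.sum_nonneg fun i _ => by split_ifs <;> norm_num)
    · refine le_trans ?_ ht'
      rw [mul_comm]
      gcongr
      refine (Finset.sum_le_sum (g := fun _ => (1 : ℝ)) fun i _ => by split_ifs <;> norm_num).trans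
        (by simp)
    · have hrw : ∀ f g : Fin k → Fin q,
          Real.exp (8 * (ρ ^ 2 * ∑ i, if f i = g i then (1 : ℝ) else 0)) ^ n
          = Real.exp ((n * (8 * ρ ^ 2)) * ∑ i, if f i = g i then (1 : ℝ) else 0) := fun f g => by
        rw [← Real.exp_nat_mul]
        congr 1
        ring
      simp_rw [hrw]
      refine (Finset.sum_le_sum fun f _ => sum_exp_agreement_le hq f).trans ?_
      have hcard : (Fintype.card (Fin k → Fin q) : ℝ) = (q : ℝ) ^ k := by simp
      have hexp : Real.exp (k * (Real.exp (n * (8 * ρ ^ 2)) / q)) ≤ 1 + α ^ 2 :=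
        (Real.le_log_iff_exp_le (by positivity)).1 hchi
      rw [Finset.sum_const, Finset.card_univ, nsmul_eq_mul, hcard]
      calc (q : ℝ) ^ k * ((q : ℝ) ^ k * Real.exp (k * (Real.exp (n * (8 * ρ ^ 2)) / q)))
          = Real.exp (k * (Real.exp (n * (8 * ρ ^ 2)) / q)) * ((q : ℝ) ^ k) ^ 2 := by ring
        _ ≤ _ := by gcongr
  exact ⟨minimaxPower_le_of_mixture_alternative _ _ hmem₀ hmem key,
    minimaxPower_le_of_mixture_null _ _ hmem₀ hmem key⟩

/-- This is the room left for `γ` in the norm constraint at the value of `β` carrying the mixture.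
-/
theorem sq_le_of_mem_Icc {x h M : ℝ} (hh : 0 ≤ h) (hM : 4 * h ≤ M) (h1 : -(h / 2) ≤ x)
    (h2 : x ≤ M - h) : x ^ 2 ≤ M ^ 2 - h * M / 2 := by
  have h3 : 0 ≤ (x + h / 2) * (M - h - x) := mul_nonneg (by linarith) (by linarith)
  have h4 : 0 ≤ (M - 3 * h / 2) * (M - h - x) := mul_nonneg (by linarith) (by linarith)
  have h5 : 0 ≤ h * (M - 4 * h) := mul_nonneg hh (by linarith)
  nlinarith [sq_nonneg h]

theorem minimaxPower_le_of_sparse_gap {d n s k q : ℕ} {α M M₁ M₂ σ η b h : ℝ} (hα : 0 < α)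
    (hM : 1 < M) (hσ : 0 < σ) (hσ₁ : σ ≤ M₁) (hσ₂ : σ ≤ M₂ / 2)
    (hk : 0 < k) (hq : 0 < q) (hkq : k * q ≤ d) (hks : k + 1 ≤ s) (hη0 : 0 ≤ η)
    (hη : η ≤ (1 - M⁻¹) / 4) (hh : 0 < h) (hhη : h ≤ σ * η ^ 2 / 2)
    (hb : |b| ≤ M₂) (hbh : |b + h| ≤ M₂)
    (hchi : k * (Real.exp (16 * n * h / (σ * k)) / q) ≤ Real.log (1 + α ^ 2)) :
    minimaxPower n α (sparseSpace d M M₁ M₂ s b) (sparseSpace d M M₁ M₂ s (b + h))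
      ≤ ((2 * α : ℝ) : EReal) := by
  have hM' : 0 < M⁻¹ := by positivity
  have hη1 : η ≤ 1 / 4 := by linarith
  have hη2 : η ^ 2 ≤ 1 / 16 := by nlinarith
  have hM₂ : 0 < M₂ := by linarith
  have hhσ : h ≤ σ / 2 := by
    have := mul_le_mul_of_nonneg_left hη2 hσ.le
    linarith
  have hk' : (0 : ℝ) < k := by exact_mod_cast hk
  -- The squared spike norm solving `σ t / (1 + t) = h`, so that the shift of `β` is exactly `h`.
  set t : ℝ := h / (σ - h) with ht
  have hd : 0 < σ - h := by linarith
  have ht0 : 0 ≤ t := by positivity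
  have ht1 : t ≤ 2 * h / σ := by
    rw [ht, div_le_div_iff₀ hd hσ]
    have := mul_le_mul_of_nonneg_left hhσ hh.le
    linarith
  have ht2 : t ≤ η ^ 2 := ht1.trans (by rw [div_le_iff₀ hσ]; linarith)
  have hρ : k * √(t / k) ^ 2 = t := by
    rw [Real.sq_sqrt (by positivity)]; field_simp
  have h1t : 1 + t = σ / (σ - h) := by rw [ht]; field_simp; ring
  have hgap : σ * t / (1 + t) = h := by rw [h1t, ht]; field_simp
  have hgam : σ ^ 2 * t / (1 + t) ^ 2 ≤ h * M₂ / 2 := by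
    have h1 : σ ^ 2 * t / (1 + t) ^ 2 = h * (σ - h) := by rw [h1t, ht]; field_simp
    rw [h1, mul_div_assoc]
    exact mul_le_mul_of_nonneg_left (by linarith) hh.le
  have hηM : 2 * η + 2 * η ^ 2 ≤ 1 - M⁻¹ := by nlinarith
  have hchi' : k * (Real.exp (n * (8 * √(t / k) ^ 2)) / q) ≤ Real.log (1 + α ^ 2) := by
    refine le_trans ?_ hchi
    gcongr
    rw [Real.sq_sqrt (by positivity)]
    calc n * (8 * (t / k)) ≤ n * (8 * ((2 * h / σ) / k)) := by gcongr
      _ = 16 * n * h / (σ * k) := by field_simp; ring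
  have hb' := abs_le.1 hb
  have hbh' := abs_le.1 hbh
  -- The sign of `2 b + h` decides which of `b` and `b + h` has the smaller absolute value and takes
  -- the mixture. The sign `m` makes the spike move `β` from the other value to that one.
  rcases le_total 0 (2 * b + h) with hc | hc
  · refine (minimaxPower_le_of_blocks (m := 1) (ρ := √(t / k)) hα hM hM₂.le hσ.le hσ₁
      (by norm_num) hq hkq hks hη0 hηM (by rw [hρ]; exact ht2) (by rw [hρ]; linarith) hbh
      (by rw [hρ, one_mul, hgap]; ring) ?_ hchi').2
    rw [hρ]
    have := sq_le_of_mem_Icc (x := b) (M := M₂) hh.le (by linarith) (by linarith) (by linarith)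
    linarith
  · refine (minimaxPower_le_of_blocks (m := -1) (ρ := √(t / k)) hα hM hM₂.le hσ.le hσ₁
      (by norm_num) hq hkq hks hη0 hηM (by rw [hρ]; exact ht2) (by rw [hρ]; linarith) hb
      (by rw [hρ, neg_mul, one_mul, neg_mul, neg_div, hgap]; ring) ?_ hchi').1
    rw [hρ]
    have := sq_le_of_mem_Icc (x := -(b + h)) (M := M₂) hh.le (by linarith) (by linarith)
      (by linarith)
    rw [neg_sq] at this
    linarith

theorem abs_le_of_sparseSpace_nonempty {d s : ℕ} {M M₁ M₂ b : ℝ}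
    (h : (sparseSpace d M M₁ M₂ s b).Nonempty) : |b| ≤ M₂ := by
  obtain ⟨θ, ⟨_, _, _, hθ⟩, hb, _⟩ := h
  have h1 := PiLp.norm_apply_le θ.coeff 0
  have h2 : θ.coeff 0 = b := hb
  rw [h2, Real.norm_eq_abs] at h1
  exact h1.trans hθ

end DenseRegression

/-! ### Choice of constants and the two regimes -/

open DenseRegression in
theorem corollary1 (α c M M₁ M₂ : ℝ) (hα₀ : 0 < α) (hα₁ : α < 1) (hc : c < 1 / 2)
    (hM : 1 < M) (hM₁ : 0 < M₁) (hM₂ : 0 < M₂) :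
    ∃ h₀ : ℝ, 0 < h₀ ∧
      -- `d n = p n - 1` is the number of nuisance covariates, so `p n = d n + 1`
      ∀ d s : ℕ → ℕ,
        (∀ᶠ n : ℕ in atTop, (s n : ℝ) * Real.log ((d n + 1 : ℕ) : ℝ) / (n : ℝ) ≤ 1 / 4) →
        (∀ᶠ n : ℕ in atTop, 2 ≤ s n ∧ (s n : ℝ) ≤ ((d n + 1 : ℕ) : ℝ) ^ c) →
        ∀ β₀ : ℝ,
          (∀ᶠ n : ℕ in atTop,
            (DenseRegression.sparseSpace (d n) M M₁ M₂ (s n) β₀).Nonempty) →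
          (∀ᶠ n : ℕ in atTop,
            (DenseRegression.sparseSpace (d n) M M₁ M₂ (s n)
              (β₀ + DenseRegression.separation h₀ n (d n + 1) (s n))).Nonempty) →
          limsup (fun n : ℕ =>
              DenseRegression.minimaxPower n α
                (DenseRegression.sparseSpace (d n) M M₁ M₂ (s n) β₀)
                (DenseRegression.sparseSpace (d n) M M₁ M₂ (s n)
                  (β₀ + DenseRegression.separation h₀ n (d n + 1) (s n)))) atTop
            ≤ ((2 * α : ℝ) : EReal) := by
  set σ := min M₁ (M₂ / 2) with hσdef
  have hσ : 0 < σ := lt_min hM₁ (by positivity)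
  set η := (1 - M⁻¹) / 4 with hηdef
  have hMinv : M⁻¹ < 1 := inv_lt_one_of_one_lt₀ hM
  have hη : 0 < η := by rw [hηdef]; linarith
  -- Chosen so that `2 c + δ = 1 - δ`: the second-moment exponent will be at most `4 p^{-δ}`.
  set δ := (1 - 2 * c) / 2 with hδdef
  have hδ : 0 < δ := by rw [hδdef]; linarith
  set ℓ := Real.log (1 + α ^ 2) with hℓdef
  have hℓ : 0 < ℓ := Real.log_pos (by nlinarith)
  -- The four bounds give, in order: a spike small enough for the eigenvalue condition; `exp λ ≤
  -- p^δ` in the sparse regime; `(h / σ)² ≤ 1 / 4`, for the tilt to have a controlled second moment;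
  -- and the chi-square bound in the parametric regime.
  set h₀ := min (min (σ * η ^ 2) (δ * σ / 64)) (min (σ / 4) (σ * √(ℓ / 8))) with hh₀def
  have hh₀ : 0 < h₀ := lt_min (lt_min (by positivity) (by positivity))
    (lt_min (by positivity) (by positivity))
  have hb1 : h₀ ≤ σ * η ^ 2 := (min_le_left _ _).trans (min_le_left _ _)
  have hb2 : h₀ ≤ δ * σ / 64 := (min_le_left _ _).trans (min_le_right _ _)
  have hb3 : h₀ ≤ σ / 4 := (min_le_right _ _).trans (min_le_left _ _)
  have hb4 : h₀ ≤ σ * √(ℓ / 8) := (min_le_right _ _).trans (min_le_right _ _)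
  refine ⟨h₀, hh₀, fun d s hL hs β₀ hne₀ hne₁ => ?_⟩
  obtain ⟨P, hP⟩ : ∃ P : ℝ, ∀ x : ℝ, P ≤ x → 4 * x ^ (-δ) ≤ ℓ := by
    have h1 : Tendsto (fun x : ℝ => 4 * x ^ (-δ)) atTop (nhds (4 * 0)) :=
      (tendsto_rpow_neg_atTop hδ).const_mul 4
    rw [mul_zero] at h1
    exact eventually_atTop.1 (h1.eventually_le_const hℓ)
  have hlarge : ∀ᶠ n : ℕ in atTop, P ^ 4 ≤ (n : ℝ) :=
    tendsto_natCast_atTop_atTop.eventually_ge_atTop _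
  refine limsup_le_of_le (h := ?_)
  filter_upwards [hL, hs, hne₀, hne₁, hlarge, eventually_ge_atTop 1]
    with n hLn hsn hne₀n hne₁n hPn hn1
  have hβ₀ := abs_le_of_sparseSpace_nonempty hne₀n
  have hβ₁ := abs_le_of_sparseSpace_nonempty hne₁n
  obtain ⟨hs2, hsc⟩ := hsn
  set p : ℝ := ((d n + 1 : ℕ) : ℝ) with hp
  have hn : (0 : ℝ) < n := by exact_mod_cast hn1
  have hp1 : 1 ≤ p := by rw [hp]; exact_mod_cast Nat.le_add_left 1 (d n)
  have hsp : (s n : ℝ) ≤ p := hsc.trans (by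
    simpa using Real.rpow_le_rpow_of_exponent_le hp1 (show c ≤ 1 by linarith))
  have hspN : s n ≤ d n + 1 := by rw [hp] at hsp; exact_mod_cast hsp
  have hs2' : (2 : ℝ) ≤ s n := by exact_mod_cast hs2
  have hlogp : 0 ≤ Real.log p := Real.log_nonneg hp1
  set L := (s n : ℝ) * Real.log p / n with hLdef
  have hL0 : 0 ≤ L := by positivity
  set r := (n : ℝ) ^ (-(1 / 2) : ℝ) with hr
  have hr0 : 0 < r := Real.rpow_pos_of_pos hn _
  have hr2 : r ^ 2 * n = 1 := by
    rw [hr, ← Real.rpow_natCast, ← Real.rpow_mul hn.le]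
    norm_num
    rw [Real.rpow_neg_one, inv_mul_cancel₀ hn.ne']
  have hsep : separation h₀ n (d n + 1) (s n) = h₀ * (r + L) := rfl
  set h := separation h₀ n (d n + 1) (s n) with hh
  have hhpos : 0 < h := by rw [hsep]; positivity
  -- The larger of the two terms determines `h` up to a factor `2`.
  rcases le_or_gt L r with hcase | hcase
  · have hle : h ≤ 2 * h₀ * r := by
      have := mul_le_mul_of_nonneg_left hcase hh₀.le
      rw [hsep]; linarith
    have hsq : (h / σ) ^ 2 * n ≤ 4 * (h₀ / σ) ^ 2 := by
      calc (h / σ) ^ 2 * n ≤ (2 * h₀ * r / σ) ^ 2 * n := by gcongr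
        _ = 4 * (h₀ / σ) ^ 2 * (r ^ 2 * n) := by ring
        _ = _ := by rw [hr2, mul_one]
    have hq1 : h₀ / σ ≤ 1 / 4 := by rw [div_le_iff₀ hσ]; linarith
    have hq2 : (h₀ / σ) ^ 2 ≤ ℓ / 8 := by
      have : h₀ / σ ≤ √(ℓ / 8) := by rw [div_le_iff₀ hσ]; linarith
      calc (h₀ / σ) ^ 2 ≤ √(ℓ / 8) ^ 2 := by gcongr
        _ = _ := Real.sq_sqrt (by positivity)
    have hq0 : 0 ≤ h₀ / σ := by positivity
    have hn1' : (1 : ℝ) ≤ n := by exact_mod_cast hn1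
    refine minimaxPower_le_of_parametric_gap hα₀ hM hM₂.le hσ (min_le_left _ _) (by omega) hβ₀
      hβ₁ ?_ ?_
    · have h1 : (h / σ) ^ 2 ≤ (h / σ) ^ 2 * n := le_mul_of_one_le_right (sq_nonneg _) hn1'
      have h2 : (h₀ / σ) ^ 2 ≤ (1 / 4) ^ 2 := by gcongr
      linarith
    · linarith
  · have hle : h ≤ 2 * h₀ * L := by
      have := mul_le_mul_of_nonneg_left hcase.le hh₀.le
      rw [hsep]; linarith
    -- Nothing assumes `p → ∞`, but this regime forces it: `√n = r n < L n = s log p ≤ p²`, so `n <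
    -- p⁴`.
    have hPp : P ≤ p := by
      by_contra! hlt
      have h1 : L * n = s n * Real.log p := by rw [hLdef]; field_simp
      have h2 : Real.log p ≤ p := (Real.log_le_sub_one_of_pos (by linarith)).trans (by linarith)
      have h3 : L * n ≤ p ^ 2 := by rw [h1, sq]; gcongr
      have h4 : r * n < p ^ 2 := lt_of_lt_of_le (by gcongr) h3
      have h5 : (r * n) ^ 2 = n := by linear_combination n * hr2
      have h6 : (r * n) ^ 2 < (p ^ 2) ^ 2 := by gcongr
      have h7 : p ^ 4 ≤ P ^ 4 := by gcongr
      have h8 : (p ^ 2) ^ 2 = p ^ 4 := by ring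
      linarith
    set k := s n - 1 with hk
    set q := d n / k with hq
    have hk0 : 0 < k := by omega
    have hkd : k ≤ d n := by omega
    have hq0 : 0 < q := Nat.div_pos hkd hk0
    have hk0' : (1 : ℝ) ≤ k := by exact_mod_cast hk0
    have hq0' : (0 : ℝ) < q := by exact_mod_cast hq0
    have hks : (s n : ℝ) ≤ 2 * k := by
      have : s n ≤ 2 * k := by omega
      exact_mod_cast this
    have hks' : (k : ℝ) ≤ p ^ c := le_trans (by exact_mod_cast Nat.sub_le _ _) hsc
    -- Rounding `d n / k` down loses only a constant factor, because `q ≥ 1`.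
    have hqd : p ≤ 4 * (k * q) := by
      have h1 : d n < k * (q + 1) := Nat.lt_mul_div_succ _ hk0
      have h2 : d n + 1 ≤ 4 * (k * q) := by nlinarith
      rw [hp]; exact_mod_cast h2
    refine minimaxPower_le_of_sparse_gap (k := k) (q := q) (η := η) hα₀ hM hσ (min_le_left _ _)
      (min_le_right _ _) hk0 hq0 (Nat.mul_div_le _ _) (by omega) hη.le le_rfl hhpos ?_ hβ₀ hβ₁ ?_
    · have h1 : h₀ * L ≤ h₀ * (1 / 4) := mul_le_mul_of_nonneg_left hLn hh₀.le
      linarith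
    · have hexp : 16 * n * h / (σ * k) ≤ Real.log p * δ := by
        rw [div_le_iff₀ (by positivity)]
        have h1 : L * n = s n * Real.log p := by rw [hLdef]; field_simp
        calc 16 * n * h ≤ 16 * n * (2 * h₀ * L) := by gcongr
          _ = 32 * h₀ * (s n * Real.log p) := by rw [← h1]; ring
          _ ≤ 32 * (δ * σ / 64) * ((2 * k) * Real.log p) := by gcongr
          _ = _ := by ring
      have hexp' : Real.exp (16 * n * h / (σ * k)) ≤ p ^ δ := by
        rw [Real.rpow_def_of_pos (by linarith)]
        exact Real.exp_le_exp.2 hexp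
      refine le_trans ?_ (hP p hPp)
      have hp0 : 0 < p := by linarith
      rw [mul_div_assoc', div_le_iff₀ hq0']
      have hkk : (k : ℝ) * k ≤ p ^ (2 * c) := by
        rw [two_mul, Real.rpow_add hp0]; gcongr
      have hpow : p ^ (2 * c) * p ^ δ = p ^ (-δ) * p := by
        rw [← Real.rpow_add hp0]
        nth_rewrite 3 [← Real.rpow_one p]
        rw [← Real.rpow_add hp0]
        congr 1
        rw [hδdef]; ring
      -- Multiplying by a further `k` brings in `k * q`, which is comparable to `p`, and `k² ≤
      -- p^{2c}`.
      have h8 : (k : ℝ) * (k * Real.exp (16 * n * h / (σ * k))) ≤ k * (4 * p ^ (-δ) * q) := by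
        calc (k : ℝ) * (k * Real.exp (16 * n * h / (σ * k)))
            = (k * k) * Real.exp (16 * n * h / (σ * k)) := by ring
          _ ≤ p ^ (2 * c) * p ^ δ := by gcongr
          _ = p ^ (-δ) * p := hpow
          _ ≤ p ^ (-δ) * (4 * (k * q)) := by gcongr
          _ = _ := by ring
      exact le_of_mul_le_mul_left h8 (by linarith)
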